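/- Write $[x,y]=\{x,x+1,\dots,y\}$ and $[n]=[1,n]$. A *cyclic interval hypergraph* on $[x,y]$ is a set $\mathbb H$ of subsets of $[x,y]$ (hyperedges) that contains all singletons $\{i\}$, $i\in[x,y]$, and each of whose other members is either a *regular* hyperedge, i.e. $[i,j]\neq[x,y]$ with $x\le i<j\le y$, or a *cyclic* hyperedge, i.e. $[j,y]\cup[x,i]$ with $x\le i<j\le y$ (in particular $[x,y]$, if $x<y$, is cyclic). Its regular part $\mathbb H_{\mathrm{reg}}$ consists of the regular hyperedges together with, by convention, all singletons; it is *closed under intersection* if $H\cap H'\in\mathbb H_{\mathrm{reg}}$ whenever $H,H'\in\mathbb H_{\mathrm{reg}}$ and $H\cap H'\ne\emptyset$. A *hugging quadruple* of $\mathbb H$ consists of four distinct hyperedges $I,I_{\mathrm{cyc}},J,J_{\mathrm{cyc}}\in\mathbb H$ with $I,J$ regular, $I_{\mathrm{cyc}},J_{\mathrm{cyc}}$ cyclic, $\{x,x+1\}\subseteq I\cap I_{\mathrm{cyc}}$ and $\{y-1,y\}\subseteq J\cap J_{\mathrm{cyc}}$; a *fix* of it is a hyperedge $H\in\mathbb H$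 with $\{x+1,y-1\}\subseteq H\subseteq I\cup I_{\mathrm{cyc}}\cup J\cup J_{\mathrm{cyc}}$. For $D=[x,y]\subseteq[n]$ the restriction $\mathbb H|_D=\{H\cap D: H\in\mathbb H\}\setminus\{\emptyset\}$ is regarded as a hypergraph on $[x,y]$. An *orientation* of $\mathbb H$ is a map $A$ assigning to each $H\in\mathbb H$ an element $A(H)\in H$. It is *acyclic* if there is no sequence $(H_1,\dots,H_k)$ of hyperedges, $k\ge2$, with $A(H_{i+1})\in H_i\setminus\{A(H_i)\}$ for $1\le i<k$ and $A(H_1)\in H_k\setminus\{A(H_k)\}$. The acyclic orientations form the poset $P_{\mathbb H}$ in which $A\le B$ iff $A(H)\le B(H)$ for all $H\in\mathbb H$. Let $\mathcal S$ be a nonempty finite set of acyclic orientations of $\mathbb H$, and put $H_{\mathcal S}=\max_{A\in\mathcal S}A(H)$ and ${}_{\mathcal S}H=\min_{A\in\mathcal S}A(H)$. For $H\in\mathbb H$ and $\ell\in H$, an *$(H,\ell)$ join sequence* is a sequence $(H_i,h_i)_{i=1}^k$, $k\ge1$, with $h_i\in H_i\in\mathbb H$, such that $H_1=H$, $h_1=\ell$,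 $h_i=(H_i)_{\mathcal S}$ for $i\ne1$, $h_i\in H_{i+1}$ and $h_i<h_{i+1}$ for $1\le i<k$, and $h_k\in H$. An *$(H,\ell)$ meet sequence* is defined in the same way with $h_i={}_{\mathcal S}(H_i)$ for $i\neq 1$ and $h_i>h_{i+1}$. Let $$X^{\mathcal S}(H,\ell)=\max\{h_k : (H_i,h_i)_{i=1}^k\text{ an }(H,\ell)\text{ join sequence}\},\qquad X^{\mathcal S}(H)=\min_{\ell\in H,\ \ell\ge H_{\mathcal S}}X^{\mathcal S}(H,\ell),$$ $${}^{\mathcal S}X(H,\ell)=\min\{h_k : (H_i,h_i)_{i=1}^k\text{ an }(H,\ell)\text{ meet sequence}\},\qquad {}^{\mathcal S}X(H)=\max_{\ell\in H,\ \ell\le {}_{\mathcal S}H}{}^{\mathcal S}X(H,\ell).$$ **Proposition.** Let $\mathbb H$ be a cyclic interval hypergraph on $[n]$ such that, for every interval $D=[x,y]$ with $1\le x<y\le n$, $(\mathbb H|_D)_{\mathrm{reg}}$ is closed under intersection and every hugging quadruple of $\mathbb H|_D$ has a fix in $\mathbb H|_D$. Then for every nonempty finite set $\mathcal S$ of acyclic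 orientations of $\mathbb H$, the join and the meet of $\mathcal S$ exist in $P_{\mathbb H}$, and for every $H\in\mathbb H$ $$\Big(\bigvee_{A\in\mathcal S}A\Big)(H)=X^{\mathcal S}(H),\qquad \Big(\bigwedge_{A\in\mathcal S}A\Big)(H)={}^{\mathcal S}X(H).$$ -/

import Mathlib

namespace CyclicHypergraph

/-! Hypergraphs on an integer interval `[x, y]` are finite families of finite sets of naturals. -/

/-- A regular hyperedge on `[x, y]`: an interval `[i, j]` with `i < j`, other than `[x, y]`. -/
def IsRegularEdge (x y : ℕ) (H : Finset ℕ) : Prop :=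
  H ≠ Finset.Icc x y ∧ ∃ i j : ℕ, x ≤ i ∧ i < j ∧ j ≤ y ∧ H = Finset.Icc i j

/-- A cyclic hyperedge on `[x, y]`: a set `[j, y] ∪ [x, i]` with `x ≤ i < j ≤ y`
(for `j = i + 1` this is `[x, y]` itself). -/
def IsCyclicEdge (x y : ℕ) (H : Finset ℕ) : Prop :=
  ∃ i j : ℕ, x ≤ i ∧ i < j ∧ j ≤ y ∧ H = Finset.Icc j y ∪ Finset.Icc x i

/-- A cyclic interval hypergraph on `[x, y]`; all singletons belong to it by convention. -/
structure IsCyclicIntervalHypergraph (x y : ℕ) (ℍ : Finset (Finset ℕ)) : Prop where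
  singleton_mem : ∀ i ∈ Finset.Icc x y, {i} ∈ ℍ
  edge_form : ∀ H ∈ ℍ,
    (∃ i ∈ Finset.Icc x y, H = {i}) ∨ IsRegularEdge x y H ∨ IsCyclicEdge x y H

/-- The restriction `{H ∩ D | H ∈ ℍ} \ {∅}`. -/
def restrict (ℍ : Finset (Finset ℕ)) (D : Finset ℕ) : Finset (Finset ℕ) :=
  (ℍ.image fun H => H ∩ D).erase ∅

/-- The regular part of a hypergraph on `[x, y]`, viewed as a hypergraph on `[x, y]`: its regular
hyperedges, together with the singletons, which every hypergraph contains by convention. -/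
def regPart (x y : ℕ) (ℍ : Finset (Finset ℕ)) : Set (Finset ℕ) :=
  {H | (H ∈ ℍ ∧ IsRegularEdge x y H) ∨ ∃ i ∈ Finset.Icc x y, H = {i}}

/-- Closed under (nonempty) intersections. -/
def ClosedUnderInter (F : Set (Finset ℕ)) : Prop :=
  ∀ H ∈ F, ∀ H' ∈ F, (H ∩ H').Nonempty → H ∩ H' ∈ F

/-- `{I, Ic, J, Jc}` is a hugging quadruple of the hypergraph `ℍ` on `[x, y]`. -/
structure IsHuggingQuadruple (x y : ℕ) (ℍ : Finset (Finset ℕ)) (I Ic J Jc : Finset ℕ) :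
    Prop where
  distinct : [I, Ic, J, Jc].Nodup
  mem_I : I ∈ ℍ
  mem_Ic : Ic ∈ ℍ
  mem_J : J ∈ ℍ
  mem_Jc : Jc ∈ ℍ
  reg_I : IsRegularEdge x y I
  reg_J : IsRegularEdge x y J
  cyc_Ic : IsCyclicEdge x y Ic
  cyc_Jc : IsCyclicEdge x y Jc
  left_I : {x, x + 1} ⊆ I
  left_Ic : {x, x + 1} ⊆ Ic
  right_J : {y, y - 1} ⊆ J
  right_Jc : {y, y - 1} ⊆ Jc

/-- `H` is a fix of the quadruple `{I, Ic, J, Jc}` of the hypergraph `ℍ` on `[x, y]`. -/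
def IsFix (x y : ℕ) (ℍ : Finset (Finset ℕ)) (I Ic J Jc H : Finset ℕ) : Prop :=
  H ∈ ℍ ∧ {x + 1, y - 1} ⊆ H ∧ H ⊆ I ∪ Ic ∪ J ∪ Jc

/-- An orientation chooses a source `A(H) ∈ H` for each hyperedge `H`. -/
@[ext]
structure Orientation (ℍ : Finset (Finset ℕ)) where
  source : {H // H ∈ ℍ} → ℕ
  source_mem : ∀ H, source H ∈ H.1

/-- `A` is cyclic: some `(E 1, …, E k)`, `k ≥ 2`, has `A(E (i+1)) ∈ E i \ {A(E i)}` for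
`1 ≤ i < k` and `A(E 1) ∈ E k \ {A(E k)}`. -/
def Orientation.IsCyclic {ℍ : Finset (Finset ℕ)} (A : Orientation ℍ) : Prop :=
  ∃ (k : ℕ) (E : ℕ → {H // H ∈ ℍ}), 2 ≤ k ∧
    (∀ i, 1 ≤ i → i < k → A.source (E (i + 1)) ∈ (E i).1 \ {A.source (E i)}) ∧
    A.source (E 1) ∈ (E k).1 \ {A.source (E k)}

/-- The elements of the source sequence poset `P_ℍ`. -/
def AcyclicOrientation (ℍ : Finset (Finset ℕ)) : Type :=
  {A : Orientation ℍ // ¬ A.IsCyclic}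

/-- The source of `H` in an acyclic orientation. -/
def AcyclicOrientation.source {ℍ : Finset (Finset ℕ)} (A : AcyclicOrientation ℍ) :
    {H // H ∈ ℍ} → ℕ :=
  A.1.source

theorem AcyclicOrientation.source_mem {ℍ : Finset (Finset ℕ)} (A : AcyclicOrientation ℍ)
    (H : {H // H ∈ ℍ}) : A.source H ∈ H.1 :=
  A.1.source_mem H

theorem AcyclicOrientation.source_injective (ℍ : Finset (Finset ℕ)) :
    Function.Injective (AcyclicOrientation.source (ℍ := ℍ)) :=
  fun _ _ h => Subtype.ext (Orientation.ext h)

/-- `A ≤ B` in `P_ℍ` iff `A(H) ≤ B(H)` for every hyperedge `H`. -/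
instance (ℍ : Finset (Finset ℕ)) : PartialOrder (AcyclicOrientation ℍ) :=
  PartialOrder.lift AcyclicOrientation.source (AcyclicOrientation.source_injective ℍ)

section Description

variable {ℍ : Finset (Finset ℕ)}

/-- `H_S`, the maximum of the sources `A(H)`, `A ∈ S`. -/
def maxSource (S : Finset (AcyclicOrientation ℍ)) (hS : S.Nonempty) (H : {H // H ∈ ℍ}) : ℕ :=
  S.sup' hS fun A => A.source H

/-- `_S H`, the minimum of the sources `A(H)`, `A ∈ S`. -/
def minSource (S : Finset (AcyclicOrientation ℍ)) (hS : S.Nonempty) (H : {H // H ∈ ℍ}) : ℕ :=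
  S.inf' hS fun A => A.source H

/-- `(E i, h i)` for `1 ≤ i ≤ k` is an `(H, ℓ)` join sequence with respect to `S`. -/
structure IsJoinSeq (S : Finset (AcyclicOrientation ℍ)) (hS : S.Nonempty) (H : {H // H ∈ ℍ})
    (l k : ℕ) (E : ℕ → {H // H ∈ ℍ}) (h : ℕ → ℕ) : Prop where
  one_le : 1 ≤ k
  mem : ∀ i, 1 ≤ i → i ≤ k → h i ∈ (E i).1
  edge_one : E 1 = H
  point_one : h 1 = l
  point_eq : ∀ i, 1 < i → i ≤ k → h i = maxSource S hS (E i)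
  step_mem : ∀ i, 1 ≤ i → i < k → h i ∈ (E (i + 1)).1
  step_lt : ∀ i, 1 ≤ i → i < k → h i < h (i + 1)
  last_mem : h k ∈ H.1

/-- `(E i, h i)` for `1 ≤ i ≤ k` is an `(H, ℓ)` meet sequence with respect to `S`. -/
structure IsMeetSeq (S : Finset (AcyclicOrientation ℍ)) (hS : S.Nonempty) (H : {H // H ∈ ℍ})
    (l k : ℕ) (E : ℕ → {H // H ∈ ℍ}) (h : ℕ → ℕ) : Prop where
  one_le : 1 ≤ k
  mem : ∀ i, 1 ≤ i → i ≤ k → h i ∈ (E i).1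
  edge_one : E 1 = H
  point_one : h 1 = l
  point_eq : ∀ i, 1 < i → i ≤ k → h i = minSource S hS (E i)
  step_mem : ∀ i, 1 ≤ i → i < k → h i ∈ (E (i + 1)).1
  step_gt : ∀ i, 1 ≤ i → i < k → h (i + 1) < h i
  last_mem : h k ∈ H.1

/-- The end points `h k` of the `(H, ℓ)` join sequences. -/
def joinEnds (S : Finset (AcyclicOrientation ℍ)) (hS : S.Nonempty) (H : {H // H ∈ ℍ})
    (l : ℕ) : Set ℕ :=
  {v | ∃ k E h, IsJoinSeq S hS H l k E h ∧ h k = v}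

/-- The end points `h k` of the `(H, ℓ)` meet sequences. -/
def meetEnds (S : Finset (AcyclicOrientation ℍ)) (hS : S.Nonempty) (H : {H // H ∈ ℍ})
    (l : ℕ) : Set ℕ :=
  {v | ∃ k E h, IsMeetSeq S hS H l k E h ∧ h k = v}

/-- `X^S(H, ℓ)`: the maximum of the end points of the `(H, ℓ)` join sequences
(attained for `ℓ ∈ H`, see `isGreatest_joinAt`). -/
noncomputable def joinAt (S : Finset (AcyclicOrientation ℍ)) (hS : S.Nonempty)
    (H : {H // H ∈ ℍ}) (l : ℕ) : ℕ :=
  sSup (joinEnds S hS H l)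

/-- `^S X(H, ℓ)`: the minimum of the end points of the `(H, ℓ)` meet sequences
(attained for `ℓ ∈ H`, see `isLeast_meetAt`). -/
noncomputable def meetAt (S : Finset (AcyclicOrientation ℍ)) (hS : S.Nonempty)
    (H : {H // H ∈ ℍ}) (l : ℕ) : ℕ :=
  sInf (meetEnds S hS H l)

/-- `X^S(H)`: the minimum of `X^S(H, ℓ)` over `ℓ ∈ H` with `ℓ ≥ H_S`
(attained, see `isLeast_joinSource`). -/
noncomputable def joinSource (S : Finset (AcyclicOrientation ℍ)) (hS : S.Nonempty)
    (H : {H // H ∈ ℍ}) : ℕ :=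
  sInf {v | ∃ l ∈ H.1, maxSource S hS H ≤ l ∧ joinAt S hS H l = v}

/-- `^S X(H)`: the maximum of `^S X(H, ℓ)` over `ℓ ∈ H` with `ℓ ≤ _S H`
(attained, see `isGreatest_meetSource`). -/
noncomputable def meetSource (S : Finset (AcyclicOrientation ℍ)) (hS : S.Nonempty)
    (H : {H // H ∈ ℍ}) : ℕ :=
  sSup {v | ∃ l ∈ H.1, l ≤ minSource S hS H ∧ meetAt S hS H l = v}

variable (S : Finset (AcyclicOrientation ℍ)) (hS : S.Nonempty) (H : {H // H ∈ ℍ})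

theorem maxSource_mem : maxSource S hS H ∈ H.1 := by
  obtain ⟨A, _, hA⟩ := S.exists_mem_eq_sup' hS fun A => A.source H
  rw [maxSource, hA]
  exact A.source_mem H

theorem minSource_mem : minSource S hS H ∈ H.1 := by
  obtain ⟨A, _, hA⟩ := S.exists_mem_eq_inf' hS fun A => A.source H
  rw [minSource, hA]
  exact A.source_mem H

theorem isGreatest_joinAt {l : ℕ} (hl : l ∈ H.1) :
    IsGreatest (joinEnds S hS H l) (joinAt S hS H l) := by
  have hne : (joinEnds S hS H l).Nonempty := by
    refine ⟨l, 1, fun _ => H, fun _ => l, ⟨le_rfl, ?_, rfl, rfl, ?_, ?_, ?_, hl⟩, rfl⟩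
    · intros; exact hl
    all_goals intros; omega
  have hb : BddAbove (joinEnds S hS H l) := by
    refine (H.1.finite_toSet.subset ?_).bddAbove
    rintro v ⟨k, E, h, hs, rfl⟩
    exact hs.last_mem
  exact ⟨Nat.sSup_mem hne hb, fun v hv => le_csSup hb hv⟩

theorem isLeast_meetAt {l : ℕ} (hl : l ∈ H.1) :
    IsLeast (meetEnds S hS H l) (meetAt S hS H l) := by
  have hne : (meetEnds S hS H l).Nonempty := by
    refine ⟨l, 1, fun _ => H, fun _ => l, ⟨le_rfl, ?_, rfl, rfl, ?_, ?_, ?_, hl⟩, rfl⟩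
    · intros; exact hl
    all_goals intros; omega
  exact ⟨Nat.sInf_mem hne, fun v hv => Nat.sInf_le hv⟩

theorem isLeast_joinSource :
    IsLeast {v | ∃ l ∈ H.1, maxSource S hS H ≤ l ∧ joinAt S hS H l = v}
      (joinSource S hS H) :=
  ⟨Nat.sInf_mem ⟨_, _, maxSource_mem S hS H, le_rfl, rfl⟩, fun _ hv => Nat.sInf_le hv⟩

theorem isGreatest_meetSource :
    IsGreatest {v | ∃ l ∈ H.1, l ≤ minSource S hS H ∧ meetAt S hS H l = v}
      (meetSource S hS H) := by
  have hb : BddAbove {v | ∃ l ∈ H.1, l ≤ minSource S hS H ∧ meetAt S hS H l = v} := by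
    refine ((H.1.finite_toSet.image (meetAt S hS H)).subset ?_).bddAbove
    rintro v ⟨l, hl, _, rfl⟩
    exact ⟨l, hl, rfl⟩
  exact ⟨Nat.sSup_mem ⟨_, _, minSource_mem S hS H, le_rfl, rfl⟩ hb, fun _ hv => le_csSup hb hv⟩

end Description

end CyclicHypergraph

/-! Write m(H) for the largest source of H over S. A join step goes from u ∈ E to m(E) > u, and l ∈
H with l ≥ m(H) is admissible if no nonempty path of join steps leads from l back into H. The
highest point of H reached from l is admissible when l ≥ m(H), and X(H, l) = l for admissible l;
hence X(H) is the least admissible element J(H). By definition J ≥ m. If B is an acyclic upper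
bound, a path from B(H) back into H would produce a cycle of B, so B(H) is admissible and J ≤ B
(`isAdmissible_of_le`). Only this uses closure under intersection. What remains is that J is
acyclic. Order cyclically the sources in a strongly connected class of J. Each hyperedge, being an
arc, covers the gap just above or just below its source. Neighbours facing each other form a
two-cycle, so otherwise all face the same way, which `false_of_ascending` and `false_of_descending`
refute. Two-cycles are excluded by an extremal hugging quadruple whose fix cannot exist
(`false_of_maximal_isBypass`); only this uses fixes. All conditions on the hypergraph are self-dual,
so the meet follows by reversing the order. -/

namespace CyclicHypergraph

open Relation

/-! ### Arcs, acyclic choices and join steps over a linear order -/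

section Arcs

variable {ι α : Type*} [LinearOrder α]

/-- `E` is a cyclic interval of the finite linearly ordered set `U`: if `E` contains `u ≤ w`, then
it contains one of the two arcs of `U` between them. -/
def IsArc (U : Finset α) (E : Set α) : Prop :=
  ∀ ⦃u v w z : α⦄, u ∈ E → w ∈ E → v ∈ U → z ∈ U → u ≤ v → v ≤ w → (z ≤ u ∨ w ≤ z) → v ∈ E ∨ z ∈ E

/-- The relation between two hyperedges that are consecutive in a cycle of `A`. -/
def Precedes (e : ι → Set α) (A : ι → α) (E F : ι) : Prop :=
  A F ∈ e E ∧ A F ≠ A E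

/-- `A` chooses a source in each hyperedge, without cycles. -/
structure IsAcyclicChoice (e : ι → Set α) (A : ι → α) : Prop where
  mem : ∀ E, A E ∈ e E
  acyclic : ∀ E, ¬ TransGen (Precedes e A) E E

/-- One step of a join sequence, where `m E` is the largest source of `E`. -/
def JoinStep (e : ι → Set α) (m : ι → α) (u v : α) : Prop :=
  ∃ E, u ∈ e E ∧ v = m E ∧ u < v

/-- `l` is a possible source of `H` in the join. -/
structure IsAdmissible (e : ι → Set α) (m : ι → α) (H : ι) (l : α) : Prop where
  mem : l ∈ e H
  le : m H ≤ l
  not_transGen : ∀ b ∈ e H, ¬ TransGen (JoinStep e m) l b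

/-- A family of arcs of `U`, with the pointwise maximum `m` of a family of acyclic choices. -/
structure IsArcSystem (U : Finset α) (e : ι → Set α) (m : ι → α) : Prop where
  subset : ∀ E, e E ⊆ U
  arc : ∀ E, IsArc U (e E)
  exists_choice : ∀ E, ∃ A, IsAcyclicChoice e A ∧ A E = m E ∧ ∀ F, A F ≤ m F

/-- The consequence of closure under intersection that is needed for two crossing hyperedges. -/
def HasCrossingEdges (e : ι → Set α) : Prop :=
  ∀ ⦃H K : ι⦄ ⦃p q r s : α⦄, p < q → q < r → r < s → p ∈ e H → q ∈ e H → r ∈ e H → s ∉ e H →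
    p ∉ e K → q ∈ e K → r ∈ e K → s ∈ e K → ∃ F, q ∈ e F ∧ r ∈ e F ∧ e F ⊆ e H ∩ e K

/-- The existence of fixes, in terms of membership. -/
def HasFixes (U : Finset α) (e : ι → Set α) : Prop :=
  ∀ ⦃x x' y' y : α⦄ ⦃I Ic J Jc : ι⦄, x ∈ U → x' ∈ U → y' ∈ U → y ∈ U → x < x' → x' < y' → y' < y →
    (∀ z ∈ U, ¬ (x < z ∧ z < x')) → (∀ z ∈ U, ¬ (y' < z ∧ z < y)) →
    x ∈ e I → x' ∈ e I → y' ∉ e I → y ∉ e I →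
    x ∈ e Ic → x' ∈ e Ic → y' ∉ e Ic → y ∈ e Ic →
    x ∉ e J → x' ∉ e J → y' ∈ e J → y ∈ e J →
    x ∈ e Jc → x' ∉ e Jc → y' ∈ e Jc → y ∈ e Jc →
    ∃ F, x' ∈ e F ∧ y' ∈ e F ∧
      ∀ v ∈ e F, x ≤ v → v ≤ y → v ∈ e I ∨ v ∈ e Ic ∨ v ∈ e J ∨ v ∈ e Jc

theorem exists_isGreatest_of_subset {U : Finset α} {s : Set α} (hs : s ⊆ U) (hne : s.Nonempty) :
    ∃ v, IsGreatest s v := by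
  obtain ⟨v, hv, hmax⟩ := Set.exists_max_image s id (U.finite_toSet.subset hs) hne
  exact ⟨v, hv, fun w hw => hmax w hw⟩

theorem exists_isLeast_of_subset {U : Finset α} {s : Set α} (hs : s ⊆ U) (hne : s.Nonempty) :
    ∃ v, IsLeast s v := by
  obtain ⟨v, hv, hmin⟩ := Set.exists_min_image s id (U.finite_toSet.subset hs) hne
  exact ⟨v, hv, fun w hw => hmin w hw⟩

variable {U : Finset α} {e : ι → Set α} {m : ι → α}

theorem IsAcyclicChoice.eq_of_mem_of_mem {A : ι → α} (hA : IsAcyclicChoice e A) {E F : ι}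
    (hE : A E ∈ e F) (hF : A F ∈ e E) : A E = A F := by
  by_contra hne
  exact hA.acyclic E (.tail (.single ⟨hF, Ne.symm hne⟩) ⟨hE, hne⟩)

theorem JoinStep.lt {u v : α} (h : JoinStep e m u v) : u < v := by
  obtain ⟨_, _, _, h⟩ := h
  exact h

theorem lt_of_transGen_joinStep {u v : α} (h : TransGen (JoinStep e m) u v) : u < v := by
  induction h with
  | single h => exact h.lt
  | tail _ h ih => exact ih.trans h.lt

theorem le_of_reflTransGen_joinStep {u v : α} (h : ReflTransGen (JoinStep e m) u v) : u ≤ v := by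
  induction h with
  | refl => exact le_rfl
  | tail _ h ih => exact ih.trans h.lt.le

/-- A path of join steps from `a` to `b` crosses each `v` in between. -/
theorem exists_joinStep_crossing {a b v : α} (h : ReflTransGen (JoinStep e m) a b) (hav : a ≤ v)
    (hvb : v < b) : ∃ g E, ReflTransGen (JoinStep e m) a g ∧ g ∈ e E ∧ g ≤ v ∧ v < m E ∧
      ReflTransGen (JoinStep e m) (m E) b := by
  induction h using ReflTransGen.head_induction_on with
  | refl => exact absurd hvb hav.not_gt
  | @head a c h h' ih =>
    rcases le_or_gt c v with hc | hc
    · obtain ⟨g, E, h1, h2⟩ := ih hc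
      exact ⟨g, E, .head h h1, h2⟩
    · obtain ⟨E, h1, rfl, h3⟩ := h
      exact ⟨a, E, .refl, h1, hav, hc, h'⟩

/-! ### Upper bounds and the least admissible choice -/

namespace IsArcSystem

theorem max_mem (hs : IsArcSystem U e m) (E : ι) : m E ∈ e E := by
  obtain ⟨A, hA, hAE, -⟩ := hs.exists_choice E
  exact hAE ▸ hA.mem E

theorem mem_ground (hs : IsArcSystem U e m) {E : ι} {v : α} (h : v ∈ e E) : v ∈ U :=
  hs.subset E h

/-- Otherwise, with A attaining `m E`, the points A H < B H < m E < B E make H and E cross. An F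
inside both, containing the middle two points, has A F = m E and B F = B H, against A F ≤ m F ≤ B F.
-/
theorem max_notMem_of_lt (hs : IsArcSystem U e m) (hc : HasCrossingEdges e) {B : ι → α}
    (hB : IsAcyclicChoice e B) (hmB : ∀ E, m E ≤ B E) {H E : ι} (hE : B H ∈ e E)
    (hlt : B H < m E) : m E ∉ e H := by
  intro hmem
  obtain ⟨A, hA, hAE, hAm⟩ := hs.exists_choice E
  have hAH : A H ≤ B H := (hAm H).trans (hmB H)
  have h1 : B E ∉ e H := fun h => by
    have := hB.eq_of_mem_of_mem h hE
    have := hmB E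
    order
  have h2 : A H ∉ e E := fun h => by
    have := hA.eq_of_mem_of_mem h (hAE ▸ hmem)
    order
  have h3 : A H < B H := lt_of_le_of_ne hAH fun h => h2 (h ▸ hE)
  have h4 : m E < B E := lt_of_le_of_ne (hmB E) fun h => h1 (h ▸ hmem)
  obtain ⟨F, hF1, hF2, hF⟩ := hc h3 hlt h4 (hA.mem H) (hB.mem H) hmem h1 h2 hE (hs.max_mem E)
    (hB.mem E)
  have h5 : A F = A E := hA.eq_of_mem_of_mem (hF (hA.mem F)).2 (hAE ▸ hF2)
  have h6 : B F = B H := hB.eq_of_mem_of_mem (hF (hB.mem F)).1 hF1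
  have := hAm F
  have := hmB F
  order

/-- Acyclic upper bounds take admissible values. -/
theorem isAdmissible_of_le (hs : IsArcSystem U e m) (hc : HasCrossingEdges e) {B : ι → α}
    (hB : IsAcyclicChoice e B) (hmB : ∀ E, m E ≤ B E) (H : ι) : IsAdmissible e m H (B H) := by
  refine ⟨hB.mem H, hmB H, fun b hb hpath => ?_⟩
  obtain ⟨_, ⟨E, hE, rfl, hlt⟩, hrest⟩ := TransGen.head'_iff.1 hpath
  have hnot := hs.max_notMem_of_lt hc hB hmB hE hlt
  have hle := le_of_reflTransGen_joinStep hrest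
  have hne : m E ≠ b := fun h => hnot (h ▸ hb)
  have hup : ∀ v ∈ U, b ≤ v → v ∈ e H := fun v hv hbv =>
    ((hs.arc H) (hB.mem H) hb (hs.mem_ground (hs.max_mem E)) hv hlt.le hle (.inr hbv)).resolve_left
      hnot
  -- Among hyperedges leading to `H` in `B` with source at least `m E`, let `G` have the highest
  -- source. The join step over `B G` uses a `K` that contains `B G` or `B H`, so `K` also leads to
  -- `H` and has a higher source.
  obtain ⟨v, ⟨G, rfl, hG, hmG⟩, hmax⟩ := exists_isGreatest_of_subset (U := U)
    (s := {v | ∃ G, B G = v ∧ TransGen (Precedes e B) G H ∧ m E ≤ B G})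
    (by rintro _ ⟨G, rfl, -⟩; exact hs.mem_ground (hB.mem G))
    ⟨B E, E, rfl, .single ⟨hE, (hlt.trans_le (hmB E)).ne⟩, hmB E⟩
  have hGb : B G < b := by
    by_contra! h
    exact hB.acyclic H (.head ⟨hup _ (hs.mem_ground (hB.mem G)) h, (hlt.trans_le hmG).ne'⟩ hG)
  obtain ⟨g, K, hg, hgK, hgv, hvK, hKb⟩ := exists_joinStep_crossing hrest hmG hGb
  have hg' := le_of_reflTransGen_joinStep hg
  have hBK : B G < B K := hvK.trans_le (hmB K)
  have key : TransGen (Precedes e B) K H := by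
    rcases (hs.arc K) hgK (hs.max_mem K) (hs.mem_ground (hB.mem G)) (hs.mem_ground (hB.mem H)) hgv
      hvK.le (.inl (hlt.le.trans hg')) with h | h
    · exact .head ⟨h, hBK.ne⟩ hG
    · exact .single ⟨h, ((hlt.trans_le hmG).trans hBK).ne⟩
  exact (hmax ⟨K, rfl, key, hmG.trans hBK.le⟩).not_gt hBK

section Join

variable {J : ι → α}

/-- By leastness v is not admissible, so it has a path back into H, possibly the single step to `m
H`. The highest point of H so reached is admissible. -/
theorem exists_transGen_of_lt (hs : IsArcSystem U e m)
    (hJ : ∀ H, IsLeast {l | IsAdmissible e m H l} (J H)) {H : ι} {v : α} (hv : v ∈ e H)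
    (hlt : v < J H) : ∃ c ∈ e H, TransGen (JoinStep e m) v c ∧ J H ≤ c := by
  have hne : {c | c ∈ e H ∧ TransGen (JoinStep e m) v c}.Nonempty := by
    by_contra hemp
    have hno : ∀ c ∈ e H, ¬ TransGen (JoinStep e m) v c := fun c hc h => hemp ⟨c, hc, h⟩
    refine hlt.not_ge ((hJ H).2 ⟨hv, ?_, hno⟩)
    by_contra! h
    exact hno _ (hs.max_mem H) (.single ⟨H, hv, rfl, h⟩)
  obtain ⟨c, ⟨hcH, hc⟩, hmax⟩ :=
    exists_isGreatest_of_subset (fun c hc => hs.mem_ground hc.1) hne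
  refine ⟨c, hcH, hc, (hJ H).2 ⟨hcH, ?_, fun d hd h => ?_⟩⟩
  · by_contra! h
    exact (hmax ⟨hs.max_mem H, hc.tail ⟨H, hcH, rfl, h⟩⟩).not_gt h
  · exact (hmax ⟨hd, hc.trans h⟩).not_gt (lt_of_transGen_joinStep h)

/-- Refutes a cycle in which every hyperedge covers the gap above its source. The first join step
from a, through some G, lands on a point covered from below by an E of the family. -/
theorem false_of_ascending (hs : IsArcSystem U e m)
    (hJ : ∀ H, IsLeast {l | IsAdmissible e m H l} (J H)) {a : α} {K : ι} (haK : a ∈ e K)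
    (hlt : a < J K) (hcov : ∀ v ∈ U, a < v → ∃ E, a ≤ J E ∧ J E < v ∧ v ∈ e E) : False := by
  have haU := hs.mem_ground haK
  obtain ⟨c, -, hc, -⟩ := hs.exists_transGen_of_lt hJ haK hlt
  obtain ⟨_, ⟨G, haG, rfl, hG⟩, -⟩ := TransGen.head'_iff.1 hc
  have hGU := hs.mem_ground (hs.max_mem G)
  by_cases hlow : ∀ z ∈ U, z ≤ a → z ∈ e G
  · obtain ⟨A, hA, hAG, hAm⟩ := hs.exists_choice G
    have hAJ : ∀ E, A E ≤ J E := fun E => (hAm E).trans (hJ E).1.le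
    -- Induction on `J F`: a source `A F` above `a` lies in some `E` with `J E < A F ≤ J F`, and
    -- then `E` precedes `F` because `A E ≤ J E`.
    have key : ∀ E, a ≤ J E → TransGen (Precedes e A) G E := by
      by_contra! hcon
      obtain ⟨F, hF1, hF2⟩ := hcon
      obtain ⟨_, ⟨F, rfl, hF1, hF2⟩, hmin⟩ := exists_isLeast_of_subset (U := U)
        (s := {v | ∃ E, J E = v ∧ a ≤ J E ∧ ¬ TransGen (Precedes e A) G E})
        (by rintro _ ⟨E, rfl, -⟩; exact hs.mem_ground (hJ E).1.mem) ⟨_, F, rfl, hF1, hF2⟩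
      rcases le_or_gt (A F) a with h | h
      · exact hF2 (.single ⟨hlow _ (hs.mem_ground (hA.mem F)) h, by order⟩)
      · obtain ⟨E, hE1, hE2, hE3⟩ := hcov _ (hs.mem_ground (hA.mem F)) h
        have hGE : TransGen (Precedes e A) G E := by
          by_contra hcon
          have := hmin ⟨E, rfl, hE1, hcon⟩
          have := hAJ F
          order
        have := hAJ E
        exact hF2 (hGE.tail ⟨hE3, by order⟩)
    obtain ⟨E, hE1, hE2, hE3⟩ := hcov _ hGU hG
    have := hAJ E
    exact hA.acyclic G ((key E hE1).tail ⟨hAG ▸ hE3, by order⟩)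
  · push Not at hlow
    obtain ⟨z, hzU, hza, hzG⟩ := hlow
    obtain ⟨E, hE1, hE2, hE3⟩ := hcov _ hGU hG
    -- As `G` misses a point below `a`, it contains the whole stretch from `a` to `m G`. So `J E`
    -- steps to `m G`, which lies in `E`.
    have hJG : J E ∈ e G := ((hs.arc G) haG (hs.max_mem G) (hs.mem_ground (hJ E).1.mem) hzU hE1
      hE2.le (.inl hza)).resolve_right hzG
    exact (hJ E).1.not_transGen _ hE3 (.single ⟨G, hJG, rfl, hE2⟩)

/-- Below M every point reached from J H can be continued upwards, so some path enters the part of U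
above M, which lies in H. -/
theorem false_of_descending (hs : IsArcSystem U e m)
    (hJ : ∀ H, IsLeast {l | IsAdmissible e m H l} (J H)) {H : ι} {M : α} (hM : J H < M)
    (htop : ∀ v ∈ U, M ≤ v → v ∈ e H)
    (hcov : ∀ v ∈ U, J H ≤ v → v < M → ∃ E, v ∈ e E ∧ v < J E) : False := by
  obtain ⟨v, ⟨hvU, hv⟩, hmax⟩ := exists_isGreatest_of_subset (U := U)
    (s := {v | v ∈ U ∧ ReflTransGen (JoinStep e m) (J H) v}) (fun v hv => hv.1)
    ⟨J H, hs.mem_ground (hJ H).1.mem, .refl⟩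
  have hle := le_of_reflTransGen_joinStep hv
  rcases lt_or_ge v M with h | h
  · obtain ⟨E, hE, hlt⟩ := hcov v hvU hle h
    obtain ⟨c, hcE, hc, -⟩ := hs.exists_transGen_of_lt hJ hE hlt
    exact (hmax ⟨hs.mem_ground hcE, hv.trans hc.to_reflTransGen⟩).not_gt
      (lt_of_transGen_joinStep hc)
  · rcases reflTransGen_iff_eq_or_transGen.1 hv with rfl | h'
    · order
    · exact (hJ H).1.not_transGen _ (htop v hvU h) h'

end Join

end IsArcSystem

/-! ### Exclusion of two-cycles -/

/-- `v > b` starts a path of join steps into the final part of the hyperedge `K`. -/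
def ReachesEnd (U : Finset α) (e : ι → Set α) (m : ι → α) (b : α) (K : ι) (v : α) : Prop :=
  b < v ∧ ∃ c ∈ e K, ReflTransGen (JoinStep e m) v c ∧ ∀ z ∈ U, c ≤ z → z ∈ e K

/-- `E` contains `a` but not `b`, and provides a join step from `a` beyond `b` from which `K` can
be reached. -/
structure IsBypass (e : ι → Set α) (m : ι → α) (a b : α) (K E : ι) : Prop where
  mem : a ∈ e E
  notMem : b ∉ e E
  lt : b < m E
  exists_path : ∃ c ∈ e K, ReflTransGen (JoinStep e m) (m E) c

/-- Two hyperedges whose least admissible sources form a cycle. -/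
structure IsTwoCycle (U : Finset α) (e : ι → Set α) (m J : ι → α) (H K : ι) : Prop where
  sys : IsArcSystem U e m
  isLeast : ∀ H, IsLeast {l | IsAdmissible e m H l} (J H)
  lt : J H < J K
  mem_left : J K ∈ e H
  mem_right : J H ∈ e K

variable {J : ι → α} {H K E : ι}

namespace IsArcSystem

/-- J H lies in K below J K, so it reaches a point of K beyond J K. The step that jumps over J K
cannot use a hyperedge containing J K, since J K is admissible for K. -/
theorem exists_isBypass (hs : IsArcSystem U e m)
    (hJ : ∀ H, IsLeast {l | IsAdmissible e m H l} (J H)) (hlt : J H < J K)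
    (hKH : J K ∈ e H) (hHK : J H ∈ e K) : ∃ E, IsBypass e m (J H) (J K) K E := by
  obtain ⟨c, hcK, hc, hle⟩ := hs.exists_transGen_of_lt hJ hHK hlt
  have hne : J K ≠ c := fun h => (hJ H).1.not_transGen _ (h ▸ hKH) hc
  obtain ⟨g, E, hg, hgE, hgb, hbE, hEc⟩ :=
    exists_joinStep_crossing hc.to_reflTransGen hlt.le (lt_of_le_of_ne hle hne)
  have hbE' : J K ∉ e E := fun h =>
    (hJ K).1.not_transGen _ hcK (TransGen.head' ⟨E, h, rfl, hbE⟩ hEc)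
  have haE := ((hs.arc E) hgE (hs.max_mem E) (hs.mem_ground hKH) (hs.mem_ground hHK) hgb hbE.le
    (.inl (le_of_reflTransGen_joinStep hg))).resolve_left hbE'
  exact ⟨E, haE, hbE', hbE, c, hcK, hEc⟩

theorem notMem_of_reachesEnd (hJ : ∀ H, IsLeast {l | IsAdmissible e m H l} (J H))
    (h : ReachesEnd U e m (J K) K (m E)) : J K ∉ e E := fun hmem => by
  obtain ⟨hlt, c, hc, hpath, -⟩ := h
  exact (hJ K).1.not_transGen _ hc (TransGen.head' ⟨E, hmem, rfl, hlt⟩ hpath)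

theorem reachesEnd_of_mem {v : α} (h : ReachesEnd U e m (J K) K (m E)) (hv : v ∈ e E)
    (hbv : J K < v) (hlt : v < m E) : ReachesEnd U e m (J K) K v := by
  obtain ⟨-, c, hc, hpath, htop⟩ := h
  exact ⟨hbv, c, hc, .head ⟨E, hv, rfl, hlt⟩ hpath, htop⟩

/-- A point overtaken by a step of the path lies in the arc that the step uses, because that arc
misses J K, and can take the same step. -/
theorem reachesEnd_of_le (hs : IsArcSystem U e m)
    (hJ : ∀ H, IsLeast {l | IsAdmissible e m H l} (J H)) {v w : α}
    (h : ReachesEnd U e m (J K) K v) (hw : w ∈ U) (hvw : v ≤ w) :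
    ReachesEnd U e m (J K) K w := by
  obtain ⟨hbv, c, hc, hpath, htop⟩ := h
  induction hpath using ReflTransGen.head_induction_on with
  | refl => exact ⟨hbv.trans_le hvw, w, htop w hw hvw, .refl, fun z hz h => htop z hz (hvw.trans h)⟩
  | @head v v' hstep hpath ih =>
    obtain ⟨G, hvG, rfl, hlt⟩ := hstep
    rcases le_or_gt (m G) w with h | h
    · exact ih h (hbv.trans hlt)
    · have hG : ReachesEnd U e m (J K) K (m G) := ⟨hbv.trans hlt, c, hc, hpath, htop⟩
      refine reachesEnd_of_mem hG ?_ (hbv.trans_le hvw) h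
      exact ((hs.arc G) hvG (hs.max_mem G) hw (hs.mem_ground (hJ K).1.mem) hvw h.le
        (.inl hbv.le)).resolve_right (notMem_of_reachesEnd hJ hG)

end IsArcSystem

theorem IsTwoCycle.mem_of_le_of_isBypass (hc : IsTwoCycle U e m J H K)
    (hE : IsBypass e m (J H) (J K) K E) {z : α} (hz : z ∈ U) (h : z ≤ J H ∨ m E ≤ z) : z ∈ e E :=
  ((hc.sys.arc E) hE.mem (hc.sys.max_mem E) (hc.sys.mem_ground hc.mem_left) hz hc.lt.le
    hE.lt.le h).resolve_left hE.notMem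

theorem IsTwoCycle.notMem_of_isBypass_of_path (hc : IsTwoCycle U e m J H K)
    (hE : IsBypass e m (J H) (J K) K E) {c : α} (hpath : ReflTransGen (JoinStep e m) (m E) c) :
    c ∉ e H := fun h =>
  (hc.isLeast H).1.not_transGen _ h (TransGen.head' ⟨E, hE.mem, rfl, hc.lt.trans hE.lt⟩ hpath)

theorem IsTwoCycle.mem_of_mem_Icc_of_isBypass (hc : IsTwoCycle U e m J H K)
    (hE : IsBypass e m (J H) (J K) K E) {v : α} (hv : v ∈ U) (hav : J H ≤ v) (hvb : v ≤ J K) :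
    v ∈ e H :=
  ((hc.sys.arc H) (hc.isLeast H).1.mem hc.mem_left hv (hc.sys.mem_ground (hc.sys.max_mem E)) hav hvb
    (.inr hE.lt.le)).resolve_right (hc.notMem_of_isBypass_of_path hE .refl)

/-- E contains everything up to J H, in particular A H, and H contains everything from J H to J K:
at most two steps suffice. -/
theorem IsTwoCycle.transGen_precedes_of_isBypass (hc : IsTwoCycle U e m J H K)
    (hE : IsBypass e m (J H) (J K) K E) {A : ι → α} (hA : IsAcyclicChoice e A) (hAE : A E = m E)
    (hAm : ∀ F, A F ≤ m F) {F : ι} (hF : A F ≤ J K) : TransGen (Precedes e A) E F := by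
  have hEb := hE.lt
  have hlt := hc.lt
  have hlow : ∀ F, A F ≤ J H → TransGen (Precedes e A) E F := fun F hF =>
    .single ⟨hc.mem_of_le_of_isBypass hE (hc.sys.mem_ground (hA.mem F)) (.inl hF),
      by order⟩
  rcases le_or_gt (A F) (J H) with h | h
  · exact hlow F h
  · have hAH : A H ≤ J H := (hAm H).trans (hc.isLeast H).1.le
    exact (hlow H hAH).tail ⟨hc.mem_of_mem_Icc_of_isBypass hE
      (hc.sys.mem_ground (hA.mem F)) h.le hF, by order⟩

theorem IsTwoCycle.max_notMem_of_isBypass (hc : IsTwoCycle U e m J H K)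
    (hE : IsBypass e m (J H) (J K) K E) : m E ∉ e K := fun hmem => by
  obtain ⟨A, hA, hAE, hAm⟩ := hc.sys.exists_choice E
  have hAK : A K ≤ J K := (hAm K).trans (hc.isLeast K).1.le
  have hEb := hE.lt
  exact hA.acyclic E ((hc.transGen_precedes_of_isBypass hE hA hAE hAm hAK).tail
    ⟨hAE ▸ hmem, by order⟩)

theorem IsTwoCycle.reachesEnd_of_isBypass (hc : IsTwoCycle U e m J H K)
    (hE : IsBypass e m (J H) (J K) K E) : ReachesEnd U e m (J K) K (m E) := by
  obtain ⟨c, hcK, hpath⟩ := hE.exists_path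
  have hnot := hc.max_notMem_of_isBypass hE
  exact ⟨hE.lt, c, hcK, hpath, fun z hz hcz =>
    ((hc.sys.arc K) (hc.isLeast K).1.mem hcK (hc.sys.mem_ground (hc.sys.max_mem E)) hz hE.lt.le
      (le_of_reflTransGen_joinStep hpath) (.inr hcz)).resolve_left hnot⟩

/-- A bypass that reaches as far to the right as possible below `J K` and then has the largest
maximal source leads to a contradiction. -/
theorem IsTwoCycle.false_of_maximal_isBypass (hc : IsTwoCycle U e m J H K)
    (hE : IsBypass e m (J H) (J K) K E) (hfix : HasFixes U e) {x : α} (hax : J H ≤ x)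
    (hxb : x < J K) (hxE : x ∈ e E)
    (hmaxx : ∀ F z, IsBypass e m (J H) (J K) K F → z ∈ e F → J H ≤ z → z < J K → z ≤ x)
    (hmaxE : ∀ F, IsBypass e m (J H) (J K) K F → x ∈ e F → m F ≤ m E) : False := by
  have hs := hc.sys
  have hJ := hc.isLeast
  have hlt := hc.lt
  have hKH := hc.mem_left
  have hHK := hc.mem_right
  have haU := hs.mem_ground hHK
  have hbU := hs.mem_ground hKH
  have hxU := hs.mem_ground hxE
  have hEU := hs.mem_ground (hs.max_mem E)
  have hbE := hE.lt
  have hTE := hc.reachesEnd_of_isBypass hE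
  have hEK := hc.max_notMem_of_isBypass hE
  have hseg : ∀ v ∈ U, J H ≤ v → v ≤ J K → v ∈ e H := fun v hv h1 h2 =>
    hc.mem_of_mem_Icc_of_isBypass hE hv h1 h2
  have hEhigh : ∀ v ∈ U, m E ≤ v → v ∈ e E := fun v hv h =>
    hc.mem_of_le_of_isBypass hE hv (.inr h)
  have hbypass : ∀ F z, z ∈ e F → J H ≤ z → z ≤ J K → ReachesEnd U e m (J K) K (m F) →
      IsBypass e m (J H) (J K) K F := fun F z hz haz hzb hT => by
    have hbF := IsArcSystem.notMem_of_reachesEnd hJ hT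
    refine ⟨?_, hbF, hT.1, hT.2.imp fun c hc => ⟨hc.1, hc.2.1⟩⟩
    exact ((hs.arc F) hz (hs.max_mem F) hbU haU hzb hT.1.le (.inl haz)).resolve_left hbF
  have hEgap : ∀ v ∈ e E, x < v → J K < v := fun v hv hxv => by
    by_contra! h
    have hne : v ≠ J K := fun h => hE.notMem (h ▸ hv)
    exact (hmaxx E v hE hv (by order) (by order)).not_gt hxv
  obtain ⟨x', ⟨hx'U, hxx'⟩, hx'min⟩ := exists_isLeast_of_subset (U := U)
    (s := {v | v ∈ U ∧ x < v}) (fun v hv => hv.1) ⟨J K, hbU, hxb⟩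
  have hx'b : x' ≤ J K := hx'min ⟨hbU, hxb⟩
  obtain ⟨c, hcK, hpath, htop⟩ := hTE.2
  have hEc : m E < c := lt_of_le_of_ne (le_of_reflTransGen_joinStep hpath)
    fun h => hEK (h ▸ hcK)
  have hcH := hc.notMem_of_isBypass_of_path hE hpath
  have hcU := hs.mem_ground hcK
  have hx'K : x' ∈ e K :=
    ((hs.arc K) (hJ K).1.mem hcK hEU hx'U hbE.le hEc.le (.inl hx'b)).resolve_left hEK
  -- `K` qualifies as `L`. The condition on the points below `m E` is weaker than membership in `K`
  -- so that a fix can take over the role of `L`, with a smaller `y`.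
  obtain ⟨y, ⟨L, hx'L, hEL, hL, hyL, hEy⟩, hymin⟩ := exists_isLeast_of_subset (U := U)
    (s := {y | ∃ L, x' ∈ e L ∧ m E ∉ e L ∧ (∀ v ∈ e L, J H ≤ v → v < m E →
      v ∈ e H ∨ v ∈ e K ∨ ReachesEnd U e m (J K) K v) ∧ y ∈ e L ∧ m E < y})
    (by rintro y ⟨L, -, -, -, h, -⟩; exact hs.mem_ground h)
    ⟨c, K, hx'K, hEK, fun v hv _ _ => .inr (.inl hv), hcK, hEc⟩
  have hyc : y ≤ c := hymin ⟨K, hx'K, hEK, fun v hv _ _ => .inr (.inl hv), hcK, hEc⟩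
  have hyU := hs.mem_ground hyL
  obtain ⟨y', ⟨hy'U, hy'y⟩, hy'max⟩ := exists_isGreatest_of_subset (U := U)
    (s := {v | v ∈ U ∧ v < y}) (fun v hv => hv.1) ⟨m E, hEU, hEy⟩
  have hEy' : m E ≤ y' := hy'max ⟨hEU, hEy⟩
  have hy'L : y' ∉ e L := fun h => by
    have hne : y' ≠ m E := fun h' => hEL (h' ▸ h)
    exact (hymin ⟨L, hx'L, hEL, hL, h, by order⟩).not_gt hy'y
  have hxL : x ∈ e L :=
    ((hs.arc L) hx'L hyL hEU hxU (by order) hEy.le (.inl hxx'.le)).resolve_left hEL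
  obtain ⟨g, G, hg, hgG, hgy', hy'G, hGc⟩ :=
    exists_joinStep_crossing hpath hEy' (hy'y.trans_le hyc)
  have hEg := le_of_reflTransGen_joinStep hg
  have hyG : y ≤ m G := by
    by_contra! h
    exact (hy'max ⟨hs.mem_ground (hs.max_mem G), h⟩).not_gt hy'G
  have hTG : ReachesEnd U e m (J K) K (m G) := ⟨by order, c, hcK, hGc, htop⟩
  have hbG := IsArcSystem.notMem_of_reachesEnd hJ hTG
  have hxG : x ∉ e G := fun h => by
    have := hmaxE G (hbypass G x h hax hxb.le hTG) h
    order
  have hGmid : ∀ v ∈ U, g ≤ v → v ≤ m G → v ∈ e G := fun v hv h1 h2 =>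
    ((hs.arc G) hgG (hs.max_mem G) hv hbU h1 h2 (.inl (by order))).resolve_right hbG
  have hGgap : ∀ v ∈ e G, x ≤ v → J K < v := fun v hv hxv => by
    by_contra! h
    exact ((hs.arc G) hv (hs.max_mem G) hbU hxU h hTG.1.le (.inl hxv)).elim hbG hxG
  have hHgap : ∀ v ∈ e H, m E ≤ v → c < v := fun v hv hEv => by
    by_contra! h
    exact ((hs.arc H) hKH hv hEU hcU hbE.le hEv (.inr h)).elim
      (hc.notMem_of_isBypass_of_path hE .refl) hcH
  -- On `[x, y]`, `H` and `L` hug the left end, `G` and `E` the right end; `L` and `E` are the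
  -- cyclic ones.
  obtain ⟨F, hx'F, hy'F, hF⟩ := hfix (I := H) (Ic := L) (J := G) (Jc := E) hxU hx'U hy'U hyU hxx'
    (by order) hy'y (fun z hz h => (hx'min ⟨hz, h.1⟩).not_gt h.2)
    (fun z hz h => (hy'max ⟨hz, h.2⟩).not_gt h.1)
    (hseg x hxU hax hxb.le) (hseg x' hx'U (by order) hx'b)
    (fun h => by have := hHgap _ h hEy'; order) (fun h => by have := hHgap _ h hEy.le; order)
    hxL hx'L hy'L hyL hxG (fun h => by have := hGgap _ h hxx'.le; order)
    (hGmid y' hy'U hgy' hy'G.le) (hGmid y hyU (by order) hyG)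
    hxE (fun h => by have := hEgap _ h hxx'; order) (hEhigh y' hy'U hEy') (hEhigh y hyU hEy.le)
  -- Otherwise `F` would be a bypass containing `x'`, against the choice of `x`.
  have hTF : ¬ ReachesEnd U e m (J K) K (m F) := fun hT =>
    (hmaxx F x' (hbypass F x' hx'F (by order) hx'b hT) hx'F (by order)
      (lt_of_le_of_ne hx'b fun h => IsArcSystem.notMem_of_reachesEnd hJ hT (h ▸ hx'F))).not_gt hxx'
  have hF' : ∀ v ∈ e F, x < v → v < m E →
      v ∈ e H ∨ v ∈ e K ∨ ReachesEnd U e m (J K) K v := fun v hv hxv hvE => by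
    rcases hF v hv hxv.le (by order) with h | h | h | h
    · exact .inl h
    · exact hL v h (by order) hvE
    · exact .inr (.inr (IsArcSystem.reachesEnd_of_mem hTG h (hGgap v h hxv.le) (by order)))
    · exact .inr (.inr (IsArcSystem.reachesEnd_of_mem hTE h (hEgap v h hxv) hvE))
  -- Otherwise `F` replaces `L` and `y'` replaces `y`, against the minimality of `y`.
  have hEF : m E ∈ e F := by
    by_contra h
    refine (hymin ⟨F, hx'F, h, fun v hv hav hvE => ?_, hy'F,
      lt_of_le_of_ne hEy' fun h' => h (h' ▸ hy'F)⟩).not_gt hy'y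
    rcases le_or_gt v x with hvx | hvx
    · exact .inl (hseg v (hs.mem_ground hv) hav (by order))
    · exact hF' v hv hvx hvE
  obtain ⟨A, hA, hAE, hAm⟩ := hs.exists_choice E
  have hpre : ∀ {F}, A F ≤ J K → TransGen (Precedes e A) E F := fun h =>
    hc.transGen_precedes_of_isBypass hE hA hAE hAm h
  have hAF : ¬ ReachesEnd U e m (J K) K (A F) := fun h =>
    hTF (hs.reachesEnd_of_le hJ h (hs.mem_ground (hs.max_mem F)) (hAm F))
  have hAFE : A F < m E := by
    by_contra! h
    exact hAF (hs.reachesEnd_of_le hJ hTE (hs.mem_ground (hA.mem F)) h)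
  have hFE : Precedes e A F E := ⟨hAE ▸ hEF, by order⟩
  -- Now `F` precedes `E`. But `A F` is at most `J K`, or lies in `H` or `K`, or reaches the end:
  -- the first three make `E` lead to `F`, and the last is excluded by `hAF`.
  have hno : ¬ TransGen (Precedes e A) E F := fun h => hA.acyclic E (h.tail hFE)
  have hbF : J K < A F := by
    by_contra! h
    exact hno (hpre h)
  have hAH : A H ≤ J H := (hAm H).trans (hJ H).1.le
  have hAK : A K ≤ J K := (hAm K).trans (hJ K).1.le
  rcases hF' (A F) (hA.mem F) (by order) hAFE with h | h | h
  · exact hno ((hpre (hAH.trans hlt.le)).tail ⟨h, by order⟩)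
  · exact hno ((hpre hAK).tail ⟨h, by order⟩)
  · exact hAF h

/-! ### Acyclicity of the least admissible choice -/

namespace IsArcSystem

/-- The least admissible choice has no cycle of length two. -/
theorem not_mem_of_lt_of_mem (hs : IsArcSystem U e m) (hfix : HasFixes U e)
    (hJ : ∀ H, IsLeast {l | IsAdmissible e m H l} (J H)) (hlt : J H < J K) (hKH : J K ∈ e H) :
    J H ∉ e K := fun hHK => by
  obtain ⟨E₀, hE₀⟩ := hs.exists_isBypass hJ hlt hKH hHK
  obtain ⟨x, ⟨hax, hxb, E₁, hE₁, hxE₁⟩, hxmax⟩ := exists_isGreatest_of_subset (U := U)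
    (s := {x | J H ≤ x ∧ x < J K ∧ ∃ E, IsBypass e m (J H) (J K) K E ∧ x ∈ e E})
    (by rintro x ⟨-, -, E, -, h⟩; exact hs.mem_ground h) ⟨J H, le_rfl, hlt, E₀, hE₀, hE₀.mem⟩
  obtain ⟨_, ⟨E, rfl, hE, hxE⟩, hEmax⟩ := exists_isGreatest_of_subset (U := U)
    (s := {v | ∃ E, m E = v ∧ IsBypass e m (J H) (J K) K E ∧ x ∈ e E})
    (by rintro _ ⟨E, rfl, -⟩; exact hs.mem_ground (hs.max_mem E)) ⟨_, E₁, rfl, hE₁, hxE₁⟩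
  have hc : IsTwoCycle U e m J H K := ⟨hs, hJ, hlt, hKH, hHK⟩
  exact hc.false_of_maximal_isBypass hE hfix hax hxb hxE
    (fun F z hF hz h1 h2 => hxmax ⟨h1, h2, F, hF, hz⟩) (fun F hF hx => hEmax ⟨F, rfl, hF, hx⟩)

/-- The least admissible choice is acyclic. -/
theorem isAcyclicChoice_of_isLeast (hs : IsArcSystem U e m) (hfix : HasFixes U e)
    (hJ : ∀ H, IsLeast {l | IsAdmissible e m H l} (J H)) : IsAcyclicChoice e J := by
  refine ⟨fun E => (hJ E).1.mem, fun E₀ hcyc => ?_⟩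
  have hmem : ∀ E, J E ∈ e E := fun E => (hJ E).1.mem
  -- The strongly connected class of the cycle: every member has a successor in `C`, so its arc runs
  -- one way or the other to another source.
  set C : Set ι := {E | TransGen (Precedes e J) E₀ E ∧ TransGen (Precedes e J) E E₀}
  have hC : ∀ E ∈ C, ∃ F ∈ C, Precedes e J E F := by
    rintro E ⟨h1, h2⟩
    obtain ⟨F, hEF, hF⟩ := TransGen.head'_iff.1 h2
    refine ⟨F, ⟨h1.tail hEF, ?_⟩, hEF⟩
    rcases reflTransGen_iff_eq_or_transGen.1 hF with rfl | h
    · exact hcyc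
    · exact h
  have hsub : J '' C ⊆ U := by
    rintro _ ⟨E, -, rfl⟩
    exact hs.mem_ground (hmem E)
  have hne : (J '' C).Nonempty := ⟨_, E₀, ⟨hcyc, hcyc⟩, rfl⟩
  obtain ⟨_, ⟨Ea, hEa, rfl⟩, hmin⟩ := exists_isLeast_of_subset hsub hne
  obtain ⟨_, ⟨Eb, hEb, rfl⟩, hmax⟩ := exists_isGreatest_of_subset hsub hne
  have hmin' : ∀ F ∈ C, J Ea ≤ J F := fun F hF => hmin ⟨F, hF, rfl⟩
  have hmax' : ∀ F ∈ C, J F ≤ J Eb := fun F hF => hmax ⟨F, hF, rfl⟩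
  have hlt : J Ea < J Eb := by
    obtain ⟨F, hF, -, hne⟩ := hC Ea hEa
    have := hmin' F hF
    have := hmax' F hF
    order
  -- `E` covers the gap above its source, or the gap below it, in the cyclic order
  set Up : ι → Prop := fun E => ∀ v ∈ U, J E ≤ v → (∀ F ∈ C, J E < J F → v ≤ J F) → v ∈ e E
  set Down : ι → Prop := fun E => ∀ v ∈ U, v ≤ J E → (∀ F ∈ C, J F < J E → J F ≤ v) → v ∈ e E
  have hUpDown : ∀ E ∈ C, (Up E ∧ (J E = J Eb → J Ea ∈ e E)) ∨
      (Down E ∧ (J E = J Ea → ∀ v ∈ U, J Eb ≤ v → v ∈ e E)) := by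
    intro E hE
    obtain ⟨F, hF, hFE, hne⟩ := hC E hE
    rcases lt_or_gt_of_ne hne with h | h
    · by_cases hin : ∀ v ∈ U, J F ≤ v → v ≤ J E → v ∈ e E
      · exact .inr ⟨fun v hv h1 h2 => hin v hv (h2 F hF h) h1,
          fun h' => absurd (hmin' F hF) (by order)⟩
      · push Not at hin
        obtain ⟨w, hw, h1, h2, hwE⟩ := hin
        have hout : ∀ z ∈ U, z ≤ J F ∨ J E ≤ z → z ∈ e E := fun z hz h' =>
          ((hs.arc E) hFE (hmem E) hw hz h1 h2 h').resolve_left hwE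
        exact .inl ⟨fun v hv h1 _ => hout v hv (.inr h1),
          fun _ => hout _ (hs.mem_ground (hmem Ea)) (.inl (hmin' F hF))⟩
    · by_cases hin : ∀ v ∈ U, J E ≤ v → v ≤ J F → v ∈ e E
      · exact .inl ⟨fun v hv h1 h2 => hin v hv h1 (h2 F hF h),
          fun h' => absurd (hmax' F hF) (by order)⟩
      · push Not at hin
        obtain ⟨w, hw, h1, h2, hwE⟩ := hin
        have hout : ∀ z ∈ U, z ≤ J E ∨ J F ≤ z → z ∈ e E := fun z hz h' =>
          ((hs.arc E) (hmem E) hFE hw hz h1 h2 h').resolve_left hwE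
        exact .inr ⟨fun v hv h1 _ => hout v hv (.inl h1),
          fun _ v hv h' => hout v hv (.inr ((hmax' F hF).trans h'))⟩
  rcases hUpDown Ea hEa with ⟨hUpa, -⟩ | ⟨-, htop⟩
  · have hpred : ∀ v, J Ea < v → (∀ E ∈ C, J Ea < J E → J E < v → Up E) →
        ∃ P ∈ C, Up P ∧ J P < v ∧ ∀ F ∈ C, J F < v → J F ≤ J P := by
      intro v hv hup
      obtain ⟨_, ⟨P, ⟨hP, hPv⟩, rfl⟩, hPmax⟩ := exists_isGreatest_of_subset (U := U)
        (s := J '' {F | F ∈ C ∧ J F < v})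
        (by rintro _ ⟨F, -, rfl⟩; exact hs.mem_ground (hmem F)) ⟨_, Ea, ⟨hEa, hv⟩, rfl⟩
      have hPmax' : ∀ F ∈ C, J F < v → J F ≤ J P := fun F hF h => hPmax ⟨F, ⟨hF, h⟩, rfl⟩
      rcases (hmin' P hP).eq_or_lt with h | h
      · exact ⟨Ea, hEa, hUpa, hv, fun F hF hFv => h ▸ hPmax' F hF hFv⟩
      · exact ⟨P, hP, hup P hP h hPv, hPv, hPmax'⟩
    -- The lowest hyperedge facing down and its neighbour below, which faces up, would form a
    -- two-cycle.
    have hnotDown : ∀ E ∈ C, J Ea < J E → ¬ Down E := by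
      by_contra! hcon
      obtain ⟨F, hF1, hF2, hF3⟩ := hcon
      obtain ⟨_, ⟨E, ⟨hE, haE, hDown⟩, rfl⟩, hEmin⟩ := exists_isLeast_of_subset (U := U)
        (s := J '' {E | E ∈ C ∧ J Ea < J E ∧ Down E})
        (by rintro _ ⟨F, -, rfl⟩; exact hs.mem_ground (hmem F)) ⟨_, F, ⟨hF1, hF2, hF3⟩, rfl⟩
      obtain ⟨P, hP, hUpP, hPE, hPmax⟩ := hpred (J E) haE fun F hF haF hFE =>
        ((hUpDown F hF).resolve_right fun h => (hEmin ⟨F, ⟨hF, haF, h.1⟩, rfl⟩).not_gt hFE).1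
      have h1 : J E ∈ e P := hUpP _ (hs.mem_ground (hmem E)) hPE.le fun F hF h => by
        by_contra! h'
        exact (hPmax F hF h').not_gt h
      exact hs.not_mem_of_lt_of_mem hfix hJ hPE h1
        (hDown _ (hs.mem_ground (hmem P)) hPE.le hPmax)
    have hUp : ∀ E ∈ C, J Ea < J E → Up E ∧ (J E = J Eb → J Ea ∈ e E) := fun E hE h =>
      (hUpDown E hE).resolve_right fun h' => hnotDown E hE h h'.1
    refine hs.false_of_ascending hJ ((hUp Eb hEb hlt).2 rfl) hlt fun v hv hav => ?_
    obtain ⟨P, hP, hUpP, hPv, hPmax⟩ := hpred v hav fun F hF haF _ => (hUp F hF haF).1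
    refine ⟨P, hmin' P hP, hPv, hUpP v hv hPv.le fun F hF h => ?_⟩
    by_contra! h'
    exact (hPmax F hF h').not_gt h
  · have hsucc : ∀ v < J Eb, ∃ Q ∈ C, v < J Q ∧ ∀ F ∈ C, v < J F → J Q ≤ J F := by
      intro v hv
      obtain ⟨_, ⟨Q, ⟨hQ, hQv⟩, rfl⟩, hQmin⟩ := exists_isLeast_of_subset (U := U)
        (s := J '' {F | F ∈ C ∧ v < J F})
        (by rintro _ ⟨F, -, rfl⟩; exact hs.mem_ground (hmem F)) ⟨_, Eb, ⟨hEb, hv⟩, rfl⟩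
      exact ⟨Q, hQ, hQv, fun F hF h => hQmin ⟨F, ⟨hF, h⟩, rfl⟩⟩
    have hba := htop rfl _ (hs.mem_ground (hmem Eb)) le_rfl
    have hDown : ∀ E ∈ C, J Ea < J E → Down E := by
      by_contra! hcon
      obtain ⟨F, hF1, hF2, hF3⟩ := hcon
      obtain ⟨_, ⟨E, ⟨hE, haE, hnot⟩, rfl⟩, hEmax⟩ := exists_isGreatest_of_subset (U := U)
        (s := J '' {E | E ∈ C ∧ J Ea < J E ∧ ¬ Down E})
        (by rintro _ ⟨F, -, rfl⟩; exact hs.mem_ground (hmem F)) ⟨_, F, ⟨hF1, hF2, hF3⟩, rfl⟩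
      obtain ⟨hUpE, hEb'⟩ := (hUpDown E hE).resolve_right fun h => hnot h.1
      rcases (hmax' E hE).eq_or_lt with h | h
      · exact hs.not_mem_of_lt_of_mem hfix hJ haE (h ▸ hba) (hEb' h)
      · obtain ⟨Q, hQ, hEQ, hQmin⟩ := hsucc (J E) h
        have hDQ : Down Q := by
          by_contra h'
          exact (hEmax ⟨Q, ⟨hQ, haE.trans hEQ, h'⟩, rfl⟩).not_gt hEQ
        have h1 : J Q ∈ e E := hUpE _ (hs.mem_ground (hmem Q)) hEQ.le hQmin
        refine hs.not_mem_of_lt_of_mem hfix hJ hEQ h1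
          (hDQ _ (hs.mem_ground (hmem E)) hEQ.le fun F hF h => ?_)
        by_contra! h'
        exact (hQmin F hF h').not_gt h
    refine hs.false_of_descending hJ hlt (htop rfl) fun v hv hav hvb => ?_
    obtain ⟨Q, hQ, hvQ, hQmin⟩ := hsucc v hvb
    refine ⟨Q, hDown Q hQ (hav.trans_lt hvQ) v hv hvQ.le fun F hF h => ?_, hvQ⟩
    by_contra! h'
    exact (hQmin F hF h').not_gt h

end IsArcSystem

end Arcs

/-! ### Reversal of the order -/

section Duality

variable {ι α : Type*} {U : Finset α} {e : ι → Set α}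

/-- The ground set, with its order reversed. -/
def dualGround (U : Finset α) : Finset αᵒᵈ :=
  U.map OrderDual.toDual.toEmbedding

/-- The hyperedges, as subsets of the ground set with its order reversed. -/
def dualEdge (e : ι → Set α) (E : ι) : Set αᵒᵈ :=
  OrderDual.ofDual ⁻¹' e E

theorem mem_dualGround {v : αᵒᵈ} : v ∈ dualGround U ↔ OrderDual.ofDual v ∈ U := by
  simp [dualGround]

theorem IsAcyclicChoice.dual {A : ι → α} (hA : IsAcyclicChoice e A) :
    IsAcyclicChoice (dualEdge e) (fun E => OrderDual.toDual (A E)) :=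
  ⟨hA.mem, hA.acyclic⟩

variable [LinearOrder α]

theorem IsArc.dual {E : Set α} (h : IsArc U E) :
    IsArc (dualGround U) (OrderDual.ofDual ⁻¹' E) := by
  intro u v w z hu hw hv hz huv hvw hzw
  exact h hw hu (mem_dualGround.1 hv) (mem_dualGround.1 hz) hvw huv hzw.symm

theorem HasCrossingEdges.dual (h : HasCrossingEdges e) : HasCrossingEdges (dualEdge e) := by
  intro H K p q r s hpq hqr hrs h1 h2 h3 h4 h5 h6 h7 h8
  obtain ⟨F, hF1, hF2, hF⟩ := h (p := OrderDual.ofDual s) (q := OrderDual.ofDual r)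
    (r := OrderDual.ofDual q) (s := OrderDual.ofDual p) hrs hqr hpq h8 h7 h6 h5 h4 h3 h2 h1
  exact ⟨F, hF2, hF1, fun v hv => (hF hv).symm⟩

theorem HasFixes.dual (h : HasFixes U e) : HasFixes (dualGround U) (dualEdge e) := by
  intro x x' y' y I Ic J Jc hx hx' hy' hy hxx hxy hyy hcx hcy i1 i2 i3 i4 k1 k2 k3 k4
    j1 j2 j3 j4 l1 l2 l3 l4
  obtain ⟨F, hF1, hF2, hF⟩ := h (x := OrderDual.ofDual y) (x' := OrderDual.ofDual y')
    (y' := OrderDual.ofDual x') (y := OrderDual.ofDual x) (I := J) (Ic := Jc) (J := I) (Jc := Ic)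
    (mem_dualGround.1 hy) (mem_dualGround.1 hy') (mem_dualGround.1 hx') (mem_dualGround.1 hx)
    hyy hxy hxx (fun z hz hh => hcy (OrderDual.toDual z) (mem_dualGround.2 hz) hh.symm)
    (fun z hz hh => hcx (OrderDual.toDual z) (mem_dualGround.2 hz) hh.symm)
    j4 j3 j2 j1 l4 l3 l2 l1 i4 i3 i2 i1 k4 k3 k2 k1
  refine ⟨F, hF2, hF1, fun v hv hxv hvy => ?_⟩
  have := hF _ hv hvy hxv
  tauto

end Duality

/-! ### Cyclic interval hypergraphs as arc systems -/

section Hypergraph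

variable {n : ℕ} {ℍ : Finset (Finset ℕ)}

/-- The hyperedges as an indexed family of sets. -/
def edgeSet (ℍ : Finset (Finset ℕ)) (H : {H // H ∈ ℍ}) : Set ℕ :=
  H.1

/-- The cyclic form with j = i + 1 is all of [1, n] and is counted as an interval, so the second
form has a genuine gap. -/
theorem IsCyclicIntervalHypergraph.edge_cases (hℍ : IsCyclicIntervalHypergraph 1 n ℍ)
    {H : Finset ℕ} (hH : H ∈ ℍ) :
    (∃ i j, 1 ≤ i ∧ i ≤ j ∧ j ≤ n ∧ ∀ v, v ∈ H ↔ i ≤ v ∧ v ≤ j) ∨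
      ∃ i j, 1 ≤ i ∧ i + 1 < j ∧ j ≤ n ∧ ∀ v, v ∈ H ↔ j ≤ v ∧ v ≤ n ∨ 1 ≤ v ∧ v ≤ i := by
  rcases hℍ.edge_form H hH with ⟨i, hi, rfl⟩ | ⟨-, i, j, h1, h2, h3, rfl⟩ | ⟨i, j, h1, h2, h3, rfl⟩
  · rw [Finset.mem_Icc] at hi
    exact .inl ⟨i, i, hi.1, le_rfl, hi.2, fun v => by rw [Finset.mem_singleton]; omega⟩
  · exact .inl ⟨i, j, h1, h2.le, h3, fun v => Finset.mem_Icc⟩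
  · by_cases h : j = i + 1
    · exact .inl ⟨1, n, le_rfl, by omega, le_rfl, fun v => by
        simp only [Finset.mem_union, Finset.mem_Icc]; omega⟩
    · exact .inr ⟨i, j, h1, by omega, h3, fun v => by
        simp only [Finset.mem_union, Finset.mem_Icc]⟩

theorem IsCyclicIntervalHypergraph.mem_Icc (hℍ : IsCyclicIntervalHypergraph 1 n ℍ)
    {H : Finset ℕ} (hH : H ∈ ℍ) {v : ℕ} (hv : v ∈ H) : 1 ≤ v ∧ v ≤ n := by
  rcases hℍ.edge_cases hH with ⟨i, j, h1, h2, h3, h⟩ | ⟨i, j, h1, h2, h3, h⟩ <;>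
    rw [h] at hv <;> omega

theorem IsCyclicIntervalHypergraph.isArc (hℍ : IsCyclicIntervalHypergraph 1 n ℍ)
    (H : {H // H ∈ ℍ}) : IsArc (Finset.Icc 1 n) (edgeSet ℍ H) := by
  intro u v w z hu hw hv hz huv hvw hzw
  simp only [edgeSet, Finset.mem_coe, Finset.mem_Icc] at *
  rcases hℍ.edge_cases H.2 with ⟨i, j, h1, h2, h3, h⟩ | ⟨i, j, h1, h2, h3, h⟩ <;>
    simp only [h] at * <;> omega

theorem mem_restrict {D : Finset ℕ} {K : Finset ℕ} :
    K ∈ restrict ℍ D ↔ K ≠ ∅ ∧ ∃ H ∈ ℍ, H ∩ D = K := by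
  simp [restrict]

theorem inter_mem_restrict {D H : Finset ℕ} (hH : H ∈ ℍ) {v : ℕ} (hv : v ∈ H) (hvD : v ∈ D) :
    H ∩ D ∈ restrict ℍ D :=
  mem_restrict.2 ⟨Finset.ne_empty_of_mem (Finset.mem_inter.2 ⟨hv, hvD⟩), H, hH, rfl⟩

theorem IsCyclicIntervalHypergraph.inter_eq_prefix (hℍ : IsCyclicIntervalHypergraph 1 n ℍ)
    {H : Finset ℕ} (hH : H ∈ ℍ) {p r s : ℕ} (hpr : p ≤ r) (hrs : r < s) (hsn : s ≤ n)
    (hp : p ∈ H) (hr : r ∈ H) (hs : s ∉ H) (h1 : 1 ≤ p) :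
    ∃ j, r ≤ j ∧ j < s ∧ H ∩ Finset.Icc p s = Finset.Icc p j := by
  rcases hℍ.edge_cases hH with ⟨i, j, h1, h2, h3, h⟩ | ⟨i, j, h1, h2, h3, h⟩ <;>
    rw [h] at hp hr hs
  · refine ⟨j, by omega, by omega, ?_⟩
    ext v
    simp only [Finset.mem_inter, Finset.mem_Icc, h]
    omega
  · refine ⟨i, by omega, by omega, ?_⟩
    ext v
    simp only [Finset.mem_inter, Finset.mem_Icc, h]
    omega

theorem IsCyclicIntervalHypergraph.inter_eq_suffix (hℍ : IsCyclicIntervalHypergraph 1 n ℍ)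
    {H : Finset ℕ} (hH : H ∈ ℍ) {p q s : ℕ} (hpq : p < q) (h1 : 1 ≤ p)
    (hp : p ∉ H) (hq : q ∈ H) (hs : s ∈ H) :
    ∃ i, p < i ∧ i ≤ q ∧ H ∩ Finset.Icc p s = Finset.Icc i s := by
  rcases hℍ.edge_cases hH with ⟨i, j, h1, h2, h3, h⟩ | ⟨i, j, h1, h2, h3, h⟩ <;>
    rw [h] at hp hq hs
  · refine ⟨i, by omega, by omega, ?_⟩
    ext v
    simp only [Finset.mem_inter, Finset.mem_Icc, h]
    omega
  · refine ⟨j, by omega, by omega, ?_⟩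
    ext v
    simp only [Finset.mem_inter, Finset.mem_Icc, h]
    omega

/-- On [p, s] the crossing hyperedges become a proper prefix and a proper suffix, both regular. A
hyperedge restricting to their intersection misses p and s, so it lies inside [p, s]. -/
theorem IsCyclicIntervalHypergraph.hasCrossingEdges (hℍ : IsCyclicIntervalHypergraph 1 n ℍ)
    (hInter : ∀ x y : ℕ, 1 ≤ x → x < y → y ≤ n →
      ClosedUnderInter (regPart x y (restrict ℍ (Finset.Icc x y)))) :
    HasCrossingEdges (edgeSet ℍ) := by
  rintro ⟨H, hH⟩ ⟨K, hK⟩ p q r s hpq hqr hrs hpH hqH hrH hsH hpK hqK hrK hsK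
  simp only [edgeSet, Finset.mem_coe] at *
  have hp := hℍ.mem_Icc hH hpH
  have hs := hℍ.mem_Icc hK hsK
  obtain ⟨j, hj1, hj2, hj⟩ := hℍ.inter_eq_prefix hH (by omega) hrs hs.2 hpH hrH hsH hp.1
  obtain ⟨i, hi1, hi2, hi⟩ := hℍ.inter_eq_suffix hK hpq hp.1 hpK hqK hsK
  have hHr : H ∩ Finset.Icc p s ∈ regPart p s (restrict ℍ (Finset.Icc p s)) := by
    refine .inl ⟨inter_mem_restrict hH hpH (Finset.mem_Icc.2 (by omega)), fun h => ?_, p, j, le_rfl,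
      by omega, by omega, hj⟩
    exact hsH (Finset.inter_eq_right.1 h (Finset.mem_Icc.2 (by omega)))
  have hKr : K ∩ Finset.Icc p s ∈ regPart p s (restrict ℍ (Finset.Icc p s)) := by
    refine .inl ⟨inter_mem_restrict hK hsK (Finset.mem_Icc.2 (by omega)), fun h => ?_, i, s,
      by omega, by omega, le_rfl, hi⟩
    exact hpK (Finset.inter_eq_right.1 h (Finset.mem_Icc.2 (by omega)))
  have hHK : H ∩ Finset.Icc p s ∩ (K ∩ Finset.Icc p s) = Finset.Icc i j := by
    rw [hi, hj]
    ext v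
    simp only [Finset.mem_inter, Finset.mem_Icc]
    omega
  have hmem := hInter p s hp.1 (by omega) hs.2 _ hHr _ hKr
    (hHK ▸ ⟨q, Finset.mem_Icc.2 (by omega)⟩)
  rw [hHK] at hmem
  rcases hmem with ⟨hmem, -⟩ | ⟨t, -, ht⟩
  · obtain ⟨-, F, hF, hFD⟩ := mem_restrict.1 hmem
    have hFD' : ∀ v, p ≤ v → v ≤ s → (v ∈ F ↔ i ≤ v ∧ v ≤ j) := fun v h1 h2 => by
      have := Finset.ext_iff.1 hFD v
      simp only [Finset.mem_inter, Finset.mem_Icc] at this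
      tauto
    have hqF : q ∈ F := (hFD' q (by omega) (by omega)).2 (by omega)
    have hrF : r ∈ F := (hFD' r (by omega) (by omega)).2 (by omega)
    have hpF : p ∉ F := fun h => by have := (hFD' p (by omega) (by omega)).1 h; omega
    have hsF : s ∉ F := fun h => by have := (hFD' s (by omega) (by omega)).1 h; omega
    refine ⟨⟨F, hF⟩, hqF, hrF, fun v hv => ?_⟩
    have hv : v ∈ F := hv
    have hvD : p ≤ v ∧ v ≤ s := by
      rcases hℍ.edge_cases hF with ⟨i, j, h1, h2, h3, h⟩ | ⟨i, j, h1, h2, h3, h⟩ <;>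
        rw [h] at hqF hpF hsF hv <;> omega
    have hvij := (hFD' v hvD.1 hvD.2).1 hv
    have hvH : v ∈ H ∩ Finset.Icc p s ∩ (K ∩ Finset.Icc p s) := hHK ▸ Finset.mem_Icc.2 hvij
    simp only [Finset.mem_inter] at hvH
    exact ⟨hvH.1.1, hvH.2.1⟩
  · have h1 : q ∈ ({t} : Finset ℕ) := ht ▸ Finset.mem_Icc.2 (by omega)
    have h2 : r ∈ ({t} : Finset ℕ) := ht ▸ Finset.mem_Icc.2 (by omega)
    rw [Finset.mem_singleton] at h1 h2
    omega

theorem IsCyclicIntervalHypergraph.hasFixes (hℍ : IsCyclicIntervalHypergraph 1 n ℍ)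
    (hFix : ∀ x y : ℕ, 1 ≤ x → x < y → y ≤ n → ∀ I Ic J Jc : Finset ℕ,
      IsHuggingQuadruple x y (restrict ℍ (Finset.Icc x y)) I Ic J Jc →
      ∃ H, IsFix x y (restrict ℍ (Finset.Icc x y)) I Ic J Jc H) :
    HasFixes (Finset.Icc 1 n) (edgeSet ℍ) := by
  rintro x x' y' y ⟨I, hI⟩ ⟨Ic, hIc⟩ ⟨J, hJ⟩ ⟨Jc, hJc⟩ hx hx' hy' hy hxx hxy hyy hcx hcy
    i1 i2 i3 i4 k1 k2 k3 k4 j1 j2 j3 j4 l1 l2 l3 l4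
  simp only [edgeSet, Finset.mem_coe, Finset.mem_Icc] at *
  obtain rfl : x' = x + 1 := by
    have := hcx (x + 1) (by omega)
    omega
  obtain rfl : y = y' + 1 := by
    have := hcy (y' + 1) (by omega)
    omega
  have hDx : x ∈ Finset.Icc x (y' + 1) := Finset.mem_Icc.2 (by omega)
  have hDx' : x + 1 ∈ Finset.Icc x (y' + 1) := Finset.mem_Icc.2 (by omega)
  have hDy' : y' ∈ Finset.Icc x (y' + 1) := Finset.mem_Icc.2 (by omega)
  have hDy : y' + 1 ∈ Finset.Icc x (y' + 1) := Finset.mem_Icc.2 (by omega)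
  have hq : IsHuggingQuadruple x (y' + 1) (restrict ℍ (Finset.Icc x (y' + 1)))
      (I ∩ Finset.Icc x (y' + 1)) (Ic ∩ Finset.Icc x (y' + 1)) (J ∩ Finset.Icc x (y' + 1))
      (Jc ∩ Finset.Icc x (y' + 1)) := by
    refine ⟨?_, inter_mem_restrict hI i1 hDx, inter_mem_restrict hIc k1 hDx,
      inter_mem_restrict hJ j3 hDy', inter_mem_restrict hJc l1 hDx, ⟨?_, ?_⟩, ⟨?_, ?_⟩, ?_, ?_,
      ?_, ?_, ?_, ?_⟩
    · have hne : ∀ {P Q : Finset ℕ} (v : ℕ), v ∈ Finset.Icc x (y' + 1) → ¬ (v ∈ P ↔ v ∈ Q) →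
          P ∩ Finset.Icc x (y' + 1) ≠ Q ∩ Finset.Icc x (y' + 1) := fun v hv hPQ h => hPQ (by
        have := Finset.ext_iff.1 h v
        simp only [Finset.mem_inter] at this
        tauto)
      simp only [List.nodup_cons, List.mem_cons, List.not_mem_nil, or_false, not_or,
        not_false_eq_true, List.nodup_nil, and_true]
      exact ⟨⟨hne (y' + 1) hDy (by tauto), hne x hDx (by tauto), hne y' hDy' (by tauto)⟩,
        ⟨hne x hDx (by tauto), hne y' hDy' (by tauto)⟩, hne x hDx (by tauto)⟩
    · exact fun h => i4 (Finset.mem_inter.1 (h ▸ hDy)).1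
    · obtain ⟨j, hj1, hj2, hj⟩ := hℍ.inter_eq_prefix hI (Nat.le_succ x)
        (by omega) hy.2 i1 i2 i4 hx.1
      exact ⟨x, j, le_rfl, by omega, by omega, hj⟩
    · exact fun h => j1 (Finset.mem_inter.1 (h ▸ hDx)).1
    · obtain ⟨i, hi1, hi2, hi⟩ := hℍ.inter_eq_suffix hJ (by omega) hx.1 j1 j3 j4
      exact ⟨i, y' + 1, by omega, by omega, le_rfl, hi⟩
    · rcases hℍ.edge_cases hIc with ⟨i, j, h1, h2, h3, h⟩ | ⟨i, j, h1, h2, h3, h⟩ <;>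
        rw [h] at k1 k2 k3 k4
      · omega
      -- Since `y' ∉ Ic`, the upper piece of the trace on `[x, y' + 1]` is the single point `y' +
      -- 1`.
      · refine ⟨i, y' + 1, by omega, by omega, le_rfl, ?_⟩
        ext v
        simp only [Finset.mem_inter, Finset.mem_union, Finset.mem_Icc, h]
        omega
    · rcases hℍ.edge_cases hJc with ⟨i, j, h1, h2, h3, h⟩ | ⟨i, j, h1, h2, h3, h⟩ <;>
        rw [h] at l1 l2 l3 l4
      · omega
      · refine ⟨x, j, by omega, by omega, by omega, ?_⟩
        ext v
        simp only [Finset.mem_inter, Finset.mem_union, Finset.mem_Icc, h]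
        omega
    all_goals
      simp only [Finset.insert_subset_iff, Finset.singleton_subset_iff, Finset.mem_inter,
        Nat.add_sub_cancel]
      tauto
  obtain ⟨F', hF', hsub, hle⟩ := hFix x (y' + 1) hx.1 (by omega) hy.2 _ _ _ _ hq
  obtain ⟨-, F, hF, rfl⟩ := mem_restrict.1 hF'
  simp only [Finset.insert_subset_iff, Finset.singleton_subset_iff, Finset.mem_inter,
    Nat.add_sub_cancel] at hsub
  refine ⟨⟨F, hF⟩, hsub.1.1, hsub.2.1, fun v hv h1 h2 => ?_⟩
  have := hle (Finset.mem_inter.2 ⟨hv, Finset.mem_Icc.2 ⟨h1, h2⟩⟩)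
  simp only [Finset.mem_union, Finset.mem_inter] at this
  tauto

/-! ### Cycles and join sequences as paths -/

/-- Paths of a relation as sequences indexed by `1, …, k + 1`. -/
theorem exists_seq_of_transGen {β : Type*} {r : β → β → Prop} {a b : β} (h : TransGen r a b) :
    ∃ (k : ℕ) (f : ℕ → β), 1 ≤ k ∧ f 1 = a ∧ (∀ i, 1 ≤ i → i < k → r (f i) (f (i + 1))) ∧
      r (f k) b := by
  induction h with
  | single h => exact ⟨1, fun _ => a, le_rfl, rfl, fun i _ _ => by omega, h⟩
  | @tail b c _ hbc ih =>
    obtain ⟨k, f, hk, hf1, hf, hfb⟩ := ih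
    refine ⟨k + 1, Function.update f (k + 1) b, by omega, ?_, fun i h1 h2 => ?_, by simpa⟩
    · rw [Function.update_of_ne (by omega), hf1]
    · rw [Function.update_of_ne (by omega : i ≠ k + 1)]
      rcases Nat.lt_succ_iff_lt_or_eq.1 h2 with h | rfl
      · rw [Function.update_of_ne (by omega)]
        exact hf i h1 h
      · rwa [Function.update_self]

theorem reflTransGen_of_seq {β : Type*} {r : β → β → Prop} {k : ℕ} {f : ℕ → β} (hk : 1 ≤ k)
    (hf : ∀ i, 1 ≤ i → i < k → r (f i) (f (i + 1))) : ReflTransGen r (f 1) (f k) := by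
  induction k, hk using Nat.le_induction with
  | base => exact .refl
  | succ k hk ih =>
    exact (ih fun i h1 h2 => hf i h1 (by omega)).tail (hf k hk (by omega))

theorem Orientation.isCyclic_iff (A : Orientation ℍ) :
    A.IsCyclic ↔ ∃ E, TransGen (Precedes (edgeSet ℍ) A.source) E E := by
  have hiff : ∀ E F : {H // H ∈ ℍ},
      A.source F ∈ E.1 \ {A.source E} ↔ Precedes (edgeSet ℍ) A.source E F := fun E F => by
    simp [Precedes, edgeSet]
  constructor
  · rintro ⟨k, E, hk, hE, hlast⟩
    exact ⟨E 1, TransGen.tail' (reflTransGen_of_seq (by omega) fun i h1 h2 =>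
      (hiff _ _).1 (hE i h1 h2)) ((hiff _ _).1 hlast)⟩
  · rintro ⟨E, hE⟩
    obtain ⟨k, f, hk, hf1, hf, hlast⟩ := exists_seq_of_transGen hE
    refine ⟨k, f, ?_, fun i h1 h2 => (hiff _ _).2 (hf i h1 h2), (hiff _ _).2 (hf1 ▸ hlast)⟩
    by_contra h
    obtain rfl : k = 1 := by omega
    exact hlast.2 (by rw [hf1])

theorem AcyclicOrientation.isAcyclicChoice (A : AcyclicOrientation ℍ) :
    IsAcyclicChoice (edgeSet ℍ) A.source :=
  ⟨A.source_mem, fun E hE => A.2 ((Orientation.isCyclic_iff A.1).2 ⟨E, hE⟩)⟩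

theorem exists_acyclicOrientation {J : {H // H ∈ ℍ} → ℕ} (hJ : IsAcyclicChoice (edgeSet ℍ) J) :
    ∃ A : AcyclicOrientation ℍ, ∀ H, A.source H = J H :=
  ⟨⟨⟨J, hJ.mem⟩, fun h => by
    obtain ⟨E, hE⟩ := (Orientation.isCyclic_iff _).1 h
    exact hJ.acyclic E hE⟩, fun _ => rfl⟩

/-- Paths of steps through hyperedges, as sequences of hyperedges and points. -/
theorem exists_seq_of_reflTransGen {s : {H // H ∈ ℍ} → ℕ} {lt : ℕ → ℕ → Prop} {l v : ℕ}
    (H : {H // H ∈ ℍ}) (h : ReflTransGen (fun u v => ∃ E, u ∈ edgeSet ℍ E ∧ v = s E ∧ lt u v) l v) :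
    ∃ (k : ℕ) (E : ℕ → {H // H ∈ ℍ}) (f : ℕ → ℕ), 1 ≤ k ∧ E 1 = H ∧ f 1 = l ∧ f k = v ∧
      (∀ i, 1 < i → i ≤ k → f i = s (E i)) ∧
      ∀ i, 1 ≤ i → i < k → f i ∈ (E (i + 1)).1 ∧ lt (f i) (f (i + 1)) := by
  induction h with
  | refl => exact ⟨1, fun _ => H, fun _ => l, le_rfl, rfl, rfl, rfl, fun i _ _ => by omega,
      fun i _ _ => by omega⟩
  | @tail v w _ hstep ih =>
    obtain ⟨k, E, f, hk, hE, hf, hfk, h1, h2⟩ := ih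
    obtain ⟨G, hvG, hw, hlt⟩ := hstep
    refine ⟨k + 1, Function.update E (k + 1) G, Function.update f (k + 1) w, by omega, ?_, ?_, ?_,
      fun i hi1 hi2 => ?_, fun i hi1 hi2 => ?_⟩
    · rw [Function.update_of_ne (by omega), hE]
    · rw [Function.update_of_ne (by omega), hf]
    · rw [Function.update_self]
    · rcases Nat.lt_or_eq_of_le hi2 with h | rfl
      · rw [Function.update_of_ne (by omega), Function.update_of_ne (by omega)]
        exact h1 i hi1 (by omega)
      · rwa [Function.update_self, Function.update_self]
    · rw [Function.update_of_ne (by omega : i ≠ k + 1)]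
      rcases Nat.lt_succ_iff_lt_or_eq.1 hi2 with h | rfl
      · rw [Function.update_of_ne (by omega), Function.update_of_ne (by omega)]
        exact h2 i hi1 h
      · rw [Function.update_self, Function.update_self, hfk]
        exact ⟨hvG, hlt⟩

variable (S : Finset (AcyclicOrientation ℍ)) (hS : S.Nonempty) (H : {H // H ∈ ℍ})

theorem mem_joinEnds_iff {l v : ℕ} (hl : l ∈ H.1) : v ∈ joinEnds S hS H l ↔
    v ∈ H.1 ∧ ReflTransGen (JoinStep (edgeSet ℍ) (maxSource S hS)) l v := by
  constructor
  · rintro ⟨k, E, f, hf, rfl⟩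
    refine ⟨hf.last_mem, hf.point_one ▸ reflTransGen_of_seq hf.one_le fun i h1 h2 => ?_⟩
    exact ⟨E (i + 1), hf.step_mem i h1 h2, hf.point_eq _ (by omega) (by omega), hf.step_lt i h1 h2⟩
  · rintro ⟨hv, hpath⟩
    obtain ⟨k, E, f, hk, hE, hf, rfl, h1, h2⟩ := exists_seq_of_reflTransGen H hpath
    refine ⟨k, E, f, ⟨hk, fun i hi1 hi2 => ?_, hE, hf, h1, fun i hi1 hi2 => (h2 i hi1 hi2).1,
      fun i hi1 hi2 => (h2 i hi1 hi2).2, hv⟩, rfl⟩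
    rcases hi1.eq_or_lt with rfl | h
    · rwa [hE, hf]
    · rw [h1 i h hi2]
      exact maxSource_mem S hS _

theorem mem_meetEnds_iff {l v : ℕ} (hl : l ∈ H.1) : v ∈ meetEnds S hS H l ↔
    v ∈ H.1 ∧ ReflTransGen (JoinStep (dualEdge (edgeSet ℍ))
      fun E => OrderDual.toDual (minSource S hS E)) (OrderDual.toDual l) (OrderDual.toDual v) := by
  constructor
  · rintro ⟨k, E, f, hf, rfl⟩
    refine ⟨hf.last_mem, hf.point_one ▸
      reflTransGen_of_seq (f := fun i => OrderDual.toDual (f i)) hf.one_le fun i h1 h2 => ?_⟩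
    exact ⟨E (i + 1), hf.step_mem i h1 h2, congrArg _ (hf.point_eq _ (by omega) (by omega)),
      hf.step_gt i h1 h2⟩
  · rintro ⟨hv, hpath⟩
    obtain ⟨k, E, f, hk, hE, hf, rfl, h1, h2⟩ :=
      exists_seq_of_reflTransGen (s := minSource S hS) (lt := fun u v => v < u) (l := l) (v := v)
        H hpath
    refine ⟨k, E, f, ⟨hk, fun i hi1 hi2 => ?_, hE, hf, h1, fun i hi1 hi2 => (h2 i hi1 hi2).1,
      fun i hi1 hi2 => (h2 i hi1 hi2).2, hv⟩, rfl⟩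
    rcases hi1.eq_or_lt with rfl | h
    · rwa [hE, hf]
    · rw [h1 i h hi2]
      exact minSource_mem S hS _

/-- The optimal end point X(H, l) is admissible, because any continuation into H would beat it;
conversely an admissible w is its own optimal end point. -/
theorem isLeast_isAdmissible_joinSource :
    IsLeast {l | IsAdmissible (edgeSet ℍ) (maxSource S hS) H l} (joinSource S hS H) := by
  obtain ⟨⟨l, hl, hle, heq⟩, hmin⟩ := isLeast_joinSource S hS H
  obtain ⟨hmem, hmax⟩ := isGreatest_joinAt S hS H hl
  rw [heq, mem_joinEnds_iff S hS H hl] at hmem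
  refine ⟨⟨hmem.1, hle.trans (le_of_reflTransGen_joinStep hmem.2), fun b hb hpath => ?_⟩,
    fun w hw => ?_⟩
  · have := hmax ((mem_joinEnds_iff S hS H hl).2 ⟨hb, hmem.2.trans hpath.to_reflTransGen⟩)
    exact (heq ▸ this).not_gt (lt_of_transGen_joinStep hpath)
  · refine hmin ⟨w, hw.mem, hw.le, ?_⟩
    obtain ⟨h1, h2⟩ := (mem_joinEnds_iff S hS H hw.mem).1 (isGreatest_joinAt S hS H hw.mem).1
    exact (reflTransGen_iff_eq_or_transGen.1 h2).resolve_right (hw.not_transGen _ h1)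

theorem isLeast_isAdmissible_meetSource :
    IsLeast {l | IsAdmissible (dualEdge (edgeSet ℍ))
      (fun E => OrderDual.toDual (minSource S hS E)) H l}
      (OrderDual.toDual (meetSource S hS H)) := by
  obtain ⟨⟨l, hl, hle, heq⟩, hmax⟩ := isGreatest_meetSource S hS H
  obtain ⟨hmem, hmin⟩ := isLeast_meetAt S hS H hl
  rw [heq, mem_meetEnds_iff S hS H hl] at hmem
  refine ⟨⟨hmem.1, le_trans (α := ℕᵒᵈ) hle (le_of_reflTransGen_joinStep hmem.2),
    fun b hb hpath => ?_⟩, fun w hw => ?_⟩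
  · have := hmin ((mem_meetEnds_iff S hS H (v := OrderDual.ofDual b) hl).2
      ⟨hb, hmem.2.trans hpath.to_reflTransGen⟩)
    exact (heq ▸ this).not_gt (lt_of_transGen_joinStep (α := ℕᵒᵈ) hpath)
  · refine hmax ⟨OrderDual.ofDual w, hw.mem, hw.le, ?_⟩
    obtain ⟨h1, h2⟩ := (mem_meetEnds_iff S hS H hw.mem).1 (isLeast_meetAt S hS H hw.mem).1
    exact (reflTransGen_iff_eq_or_transGen.1 h2).resolve_right (hw.not_transGen _ h1)

theorem isArcSystem_maxSource (hℍ : IsCyclicIntervalHypergraph 1 n ℍ) :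
    IsArcSystem (Finset.Icc 1 n) (edgeSet ℍ) (maxSource S hS) := by
  refine ⟨fun E v hv => Finset.mem_coe.2 (Finset.mem_Icc.2 (hℍ.mem_Icc E.2 hv)), hℍ.isArc,
    fun E => ?_⟩
  obtain ⟨A, hA, hAE⟩ := S.exists_mem_eq_sup' hS fun A => A.source E
  exact ⟨A.source, A.isAcyclicChoice, hAE.symm, fun F =>
    Finset.le_sup' (fun A : AcyclicOrientation ℍ => A.source F) hA⟩

theorem isArcSystem_minSource (hℍ : IsCyclicIntervalHypergraph 1 n ℍ) :
    IsArcSystem (dualGround (Finset.Icc 1 n)) (dualEdge (edgeSet ℍ))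
      (fun E => OrderDual.toDual (minSource S hS E)) := by
  refine ⟨fun E v hv => Finset.mem_coe.2 (mem_dualGround.2 (Finset.mem_Icc.2
    (hℍ.mem_Icc E.2 hv))), fun E => (hℍ.isArc E).dual, fun E => ?_⟩
  obtain ⟨A, hA, hAE⟩ := S.exists_mem_eq_inf' hS fun A => A.source E
  exact ⟨fun F => OrderDual.toDual (A.source F), A.isAcyclicChoice.dual, congrArg _ hAE.symm,
    fun F => Finset.inf'_le (fun A : AcyclicOrientation ℍ => A.source F) hA⟩

end Hypergraph

end CyclicHypergraph

open CyclicHypergraph in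
theorem proposition6p3 (n : ℕ) (ℍ : Finset (Finset ℕ))
    (hℍ : CyclicHypergraph.IsCyclicIntervalHypergraph 1 n ℍ)
    (hInter : ∀ x y : ℕ, 1 ≤ x → x < y → y ≤ n →
      CyclicHypergraph.ClosedUnderInter
        (CyclicHypergraph.regPart x y (CyclicHypergraph.restrict ℍ (Finset.Icc x y))))
    (hFix : ∀ x y : ℕ, 1 ≤ x → x < y → y ≤ n → ∀ I Ic J Jc : Finset ℕ,
      CyclicHypergraph.IsHuggingQuadruple x y
        (CyclicHypergraph.restrict ℍ (Finset.Icc x y)) I Ic J Jc →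
      ∃ H, CyclicHypergraph.IsFix x y
        (CyclicHypergraph.restrict ℍ (Finset.Icc x y)) I Ic J Jc H)
    (S : Finset (CyclicHypergraph.AcyclicOrientation ℍ)) (hS : S.Nonempty) :
    (∃ J : CyclicHypergraph.AcyclicOrientation ℍ, IsLUB (S : Set _) J ∧
      ∀ H, J.source H = CyclicHypergraph.joinSource S hS H) ∧
    (∃ M : CyclicHypergraph.AcyclicOrientation ℍ, IsGLB (S : Set _) M ∧
      ∀ H, M.source H = CyclicHypergraph.meetSource S hS H) := by
  have hc := hℍ.hasCrossingEdges hInter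
  have hf := hℍ.hasFixes hFix
  constructor
  · have hs := isArcSystem_maxSource S hS hℍ
    have hJ := isLeast_isAdmissible_joinSource S hS
    obtain ⟨J, hJs⟩ := exists_acyclicOrientation (hs.isAcyclicChoice_of_isLeast hf hJ)
    refine ⟨J, ⟨fun A hA H => ?_, fun B hB H => ?_⟩, hJs⟩
    · rw [hJs]
      exact (Finset.le_sup' (fun A : AcyclicOrientation ℍ => A.source H) hA).trans (hJ H).1.le
    · rw [hJs]
      exact (hJ H).2 (hs.isAdmissible_of_le hc B.isAcyclicChoice
        (fun E => Finset.sup'_le hS _ fun A hA => hB hA E) H)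
  · have hs := isArcSystem_minSource S hS hℍ
    have hJ := isLeast_isAdmissible_meetSource S hS
    have hM : IsAcyclicChoice (edgeSet ℍ) (meetSource S hS) :=
      (hs.isAcyclicChoice_of_isLeast hf.dual hJ).dual
    obtain ⟨M, hMs⟩ := exists_acyclicOrientation hM
    refine ⟨M, ⟨fun A hA H => ?_, fun B hB H => ?_⟩, hMs⟩
    · rw [hMs]
      exact le_trans (hJ H).1.le
        (Finset.inf'_le (fun A : AcyclicOrientation ℍ => A.source H) hA)
    · rw [hMs]
      exact (hJ H).2 (hs.isAdmissible_of_le hc.dual B.isAcyclicChoice.dual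
        (fun E => Finset.le_inf' hS _ fun A hA => hB hA E) H)
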